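/- All graphs are finite and simple. For graphs $F$ and $G$, let $ex_F(n,G)$ (the $F$-multicolor Turán number of $G$) be the maximum number of pairwise edge-disjoint copies of $F$ on an $n$-element vertex set such that there is no copy of $G$ whose edges come from distinct copies of $F$ in the collection; if no collection (not even the empty one) qualifies, put $ex_F(n,G)=0$. Let $ex(n,G)$ be the usual Turán number, i.e. the maximum number of edges in an $n$-vertex $G$-free graph (and $0$ if there is no such graph), and let $C_m$ be the cycle of length $m$ (with $C_2$ read as a single edge). **Theorem.** (1) If $F$ has at least one edge and $G$ is bipartite, then $ex_F(n,G)=O(ex(n,G))$ as $n\to\infty$, where the implied constant may depend on $F$ and $G$. In particular, for all integers $s\ge 3$ and $\ell\ge 1$, $ex_{C_s}(n,C_{2\ell})=O(n^{1+1/\ell})$ as $n\to\infty$, where the implied constant may depend on $s$ and $\ell$. (2) For all integers $k\ge 1$, $\ell>k$ and $n\ge 0$, $$ex_{C_{2k+1}}(n,C_{2\ell+1})\le 8(k+1)^2\,\ell\, n^{1+1/\lceil \ell/k\rceil}.$$ -/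

import Mathlib

open Filter Asymptotics

/-- `𝒞` is a family of pairwise edge-disjoint copies of `F` on the vertex set `U`
("monochromatic `F`-copies"; the members of `𝒞` serve as the colours).
A copy of `F` is a subgraph of the complete graph on `U` isomorphic to `F`. -/
def IsEdgeDisjointFamily {V U : Type*} (F : SimpleGraph V)
    (𝒞 : Finset (⊤ : SimpleGraph U).Subgraph) : Prop :=
  (∀ C ∈ 𝒞, Nonempty (F ≃g C.coe)) ∧
    (𝒞 : Set (⊤ : SimpleGraph U).Subgraph).PairwiseDisjoint SimpleGraph.Subgraph.edgeSet

/-- The union of the subgraphs in `𝒞` contains a rainbow copy of `G`: a copy of `G`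
(given by an injection of vertices) whose edges come from distinct members of `𝒞`. -/
def HasRainbowCopy {W U : Type*} (𝒞 : Finset (⊤ : SimpleGraph U).Subgraph)
    (G : SimpleGraph W) : Prop :=
  ∃ (f : W ↪ U) (c : G.edgeSet → (⊤ : SimpleGraph U).Subgraph),
    Function.Injective c ∧
      ∀ e : G.edgeSet, c e ∈ 𝒞 ∧ Sym2.map f (e : Sym2 W) ∈ (c e).edgeSet

/-- The numbers `t` such that there are `t` pairwise edge-disjoint copies of `F` on an
`n`-element vertex set without a rainbow copy of `G`. -/
def multicolorTuranSizes {V W : Type*} (F : SimpleGraph V) (n : ℕ) (G : SimpleGraph W) :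
    Set ℕ :=
  {t | ∃ 𝒞 : Finset (⊤ : SimpleGraph (Fin n)).Subgraph,
    IsEdgeDisjointFamily F 𝒞 ∧ ¬ HasRainbowCopy 𝒞 G ∧ 𝒞.card = t}

/-- The supremum defining the multicolor Turán number is over a bounded set. -/
theorem bddAbove_multicolorTuranSizes {V W : Type*} (F : SimpleGraph V) (n : ℕ)
    (G : SimpleGraph W) : BddAbove (multicolorTuranSizes F n G) := by
  classical
  have : Fintype (⊤ : SimpleGraph (Fin n)).Subgraph := Fintype.ofFinite _
  refine ⟨Fintype.card (⊤ : SimpleGraph (Fin n)).Subgraph, ?_⟩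
  rintro t ⟨𝒞, -, -, rfl⟩
  exact Finset.card_le_univ 𝒞

/-- The `F`-multicolor Turán number `ex_F(n, G)`: the maximum number of pairwise edge-disjoint
copies of `F` on an `n`-element vertex set without a copy of `G` whose edges come from distinct
copies of `F`. -/
noncomputable def multicolorTuran {V W : Type*} (F : SimpleGraph V) (n : ℕ)
    (G : SimpleGraph W) : ℕ :=
  sSup (multicolorTuranSizes F n G)

/-! Picking one edge from each copy of `F` gives edges of distinct colours, so a copy of `G` among
them would be rainbow: the chosen edges form a `G`-free graph with as many edges as there are copies
(`multicolorTuran_le_extremalNumber`). For even cycles this is combined with the Bondy–Simonovits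
theorem, which comes from the machinery of the odd case with every edge its own colour.

For odd cycles, suppose there are too many copies. Pass to a vertex set in which every vertex lies
in many copies, and grow a rainbow breadth-first tree from one of its vertices, maximal at each
level; an edge skipping a level then has a colour already used in the tree. A copy of `C_{2k+1}`
that meets the ball of radius `i` and whose colour is unused up to level `i + k` moves by at most
one level per step, so it stays in the ball of radius `i + k` and, having odd length, has an edge
inside a level (`exists_horizontal_step`). One such edge per copy gives a set of distinctly coloured
edges. If it had more than `2ℓ` edges per vertex, a path in it could be closed up through the tree
to a rainbow `C_{2ℓ+1}` (`IsRainbowTree.exists_odd_isRainbowCycle`).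

Hence the copies meeting a ball of radius `i` number at most linearly many in the size of the ball
of radius `i + k` (`IsRainbowTree.card_copies_touching_le`). Double counting makes the balls grow by
a factor `n^(1/⌈ℓ/k⌉)` every `k` levels, and the ball of radius `ℓ` would have more than `n`
vertices. -/

/-! ### Dense subhypergraphs, double counting and greedy paths -/

open Finset in
/-- If a finite hypergraph has more than `D` hyperedges per vertex, some nonempty vertex set `S'`
induces a subhypergraph in which every vertex has degree more than `D`. -/
theorem exists_subset_forall_lt_degree {U ι : Type*} [DecidableEq U] (K : Finset ι)
    (e : ι → Finset U) (he : ∀ κ ∈ K, (e κ).Nonempty) (S : Finset U) (hS : ∀ κ ∈ K, e κ ⊆ S)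
    (D : ℝ) (hD : D * #S < #K) :
    ∃ S' ⊆ S, S'.Nonempty ∧ ∀ v ∈ S', D < #{κ ∈ K | e κ ⊆ S' ∧ v ∈ e κ} := by
  have hS0 : D * #S < #{κ ∈ K | e κ ⊆ S} := by rwa [filter_true_of_mem hS]
  -- In an inclusion-minimal set with more than `D` hyperedges per vertex, deleting a vertex of
  -- degree at most `D` would keep the density, so no such vertex exists.
  obtain ⟨S', hS', hmin⟩ := exists_minimal_le_of_wellFoundedLT
    (fun T : Finset U => D * #T < #{κ ∈ K | e κ ⊆ T}) S hS0
  refine ⟨S', hS', ?_, ?_⟩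
  · rw [nonempty_iff_ne_empty]
    rintro rfl
    have h : D * #(∅ : Finset U) < #{κ ∈ K | e κ ⊆ ∅} := hmin.1
    have : ({κ ∈ K | e κ ⊆ ∅} : Finset ι) = ∅ := by
      apply filter_eq_empty_iff.2
      intro κ hκ h
      exact (he κ hκ).ne_empty (subset_empty.1 h)
    rw [this] at h
    simp at h
  · intro v hv
    by_contra! hlt
    have h1 : D * #(S'.erase v) < #{κ ∈ K | e κ ⊆ S'.erase v} := by
      have h2 : #{κ ∈ K | e κ ⊆ S'} ≤
          #{κ ∈ K | e κ ⊆ S'.erase v} + #{κ ∈ K | e κ ⊆ S' ∧ v ∈ e κ} := by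
        classical
        refine (card_le_card ?_).trans (card_union_le _ _)
        intro κ hκ
        simp only [mem_filter, mem_union, subset_erase] at hκ ⊢
        tauto
      have h3 : (#{κ ∈ K | e κ ⊆ S'} : ℝ) ≤
          #{κ ∈ K | e κ ⊆ S'.erase v} + #{κ ∈ K | e κ ⊆ S' ∧ v ∈ e κ} := by exact_mod_cast h2
      have h4 := hmin.1
      rw [card_erase_of_mem hv, Nat.cast_sub (card_pos.2 ⟨v, hv⟩)]
      push_cast
      linarith
    exact notMem_erase v S' (hmin.2 h1 (erase_subset v S') hv)

open Finset in
/-- A graph with more than `D` edges per vertex has a nonempty induced subgraph of minimum degree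
more than `D`. -/
theorem exists_subset_forall_lt_card_neighbors {U : Type*} [DecidableEq U] (E : Finset (Sym2 U))
    (S : Finset U) (hS : ∀ e ∈ E, ∀ v ∈ e, v ∈ S)
    (D : ℝ) (hD : D * #S < #E) :
    ∃ S' ⊆ S, S'.Nonempty ∧ ∀ v ∈ S', D < #{u ∈ S' | s(v, u) ∈ E} := by
  obtain ⟨S', hS', hne, h⟩ := exists_subset_forall_lt_degree E (fun e => e.toFinset)
    (fun e _ => by
      induction e with
      | _ a b => exact ⟨a, by simp⟩) S
    (fun e he v hv => hS e he v (by simpa using hv)) D hD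
  refine ⟨S', hS', hne, fun v hv => (h v hv).trans_le ?_⟩
  norm_cast
  refine (card_le_card ?_).trans (card_image_le (f := fun u => s(v, u)))
  intro e he
  simp only [mem_filter, Sym2.mem_toFinset] at he
  obtain ⟨heE, heS, u, rfl⟩ := he
  exact mem_image.2 ⟨u, mem_filter.2 ⟨heS (by simp), heE⟩, rfl⟩

open Finset in
/-- Double counting of vertex-hyperedge incidences. -/
theorem mul_card_le_mul_card_touching {U ι : Type*} [DecidableEq U] (K : Finset ι)
    (e : ι → Finset U) (s : ℕ) (he : ∀ κ ∈ K, #(e κ) ≤ s) (B : Finset U)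
    (d : ℝ) (hd : ∀ v ∈ B, d ≤ #{κ ∈ K | v ∈ e κ}) :
    d * #B ≤ s * #{κ ∈ K | ∃ v ∈ B, v ∈ e κ} := by
  have h1 : ∑ v ∈ B, #{κ ∈ K | v ∈ e κ} = ∑ κ ∈ K, #{v ∈ B | v ∈ e κ} :=
    sum_card_bipartiteAbove_eq_sum_card_bipartiteBelow (fun v κ => v ∈ e κ)
  have h2 : ∑ κ ∈ K, #{v ∈ B | v ∈ e κ} ≤ #{κ ∈ K | ∃ v ∈ B, v ∈ e κ} * s := by
    rw [card_filter, sum_mul]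
    refine sum_le_sum fun κ hκ => ?_
    split_ifs with h
    · rw [one_mul]
      exact (card_le_card fun v hv => (mem_filter.1 hv).2).trans (he κ hκ)
    · rw [zero_mul, Nat.le_zero, card_eq_zero, filter_eq_empty_iff]
      exact fun v hv hv' => h ⟨v, hv, hv'⟩
  calc d * #B = ∑ v ∈ B, d := by rw [sum_const, nsmul_eq_mul, mul_comm]
    _ ≤ ∑ v ∈ B, (#{κ ∈ K | v ∈ e κ} : ℝ) := sum_le_sum hd
    _ = ((∑ v ∈ B, #{κ ∈ K | v ∈ e κ} : ℕ) : ℝ) := by push_cast; rfl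
    _ ≤ ((#{κ ∈ K | ∃ v ∈ B, v ∈ e κ} * s : ℕ) : ℝ) := by rw [h1]; exact_mod_cast h2
    _ = _ := by push_cast; ring

open Finset in
/-- In a graph of minimum degree more than `k + #X` there is a path of length `k` from any given
vertex outside `X` that avoids `X`. -/
theorem exists_path_avoiding {U : Type*} [DecidableEq U] (E : Finset (Sym2 U)) (S : Finset U)
    (D : ℕ) (hdeg : ∀ v ∈ S, D < #{u ∈ S | s(v, u) ∈ E}) (X : Finset U) (p : U) (hp : p ∈ S)
    (hpX : p ∉ X) (k : ℕ) (hk : k + #X ≤ D) :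
    ∃ q : ℕ → U, q 0 = p ∧ Set.InjOn q (Set.Iic k) ∧ (∀ i ≤ k, q i ∈ S ∧ q i ∉ X) ∧
      ∀ i < k, s(q i, q (i + 1)) ∈ E := by
  induction k with
  | zero =>
    refine ⟨fun _ => p, rfl, ?_, fun i _ => ⟨hp, hpX⟩, fun i hi => absurd hi (by lia)⟩
    intro a ha b hb _
    simp only [Set.mem_Iic] at ha hb
    lia
  | succ k ih =>
    obtain ⟨q, q0, qinj, qS, qE⟩ := ih (by lia)
    -- At most `k + 1 + #X ≤ D` vertices are forbidden, fewer than the degree of `q k`.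
    obtain ⟨u, hu, hu'⟩ : ∃ u ∈ ({u ∈ S | s(q k, u) ∈ E} : Finset U),
        u ∉ (range (k + 1)).image q ∪ X := by
      apply exists_mem_notMem_of_card_lt_card
      have h1 := hdeg _ (qS k le_rfl).1
      have h2 := card_union_le ((range (k + 1)).image q) X
      have h3 := card_image_le (s := range (k + 1)) (f := q)
      rw [card_range] at h3
      lia
    simp only [mem_filter] at hu
    simp only [mem_union, mem_image, mem_range, not_or, not_exists, not_and] at hu'
    have key : ∀ i ≤ k, Function.update q (k + 1) u i = q i := fun i hi =>
      Function.update_of_ne (by lia) _ _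
    refine ⟨Function.update q (k + 1) u, by rw [key 0 (by lia), q0], ?_, ?_, ?_⟩
    · intro a ha b hb hab
      simp only [Set.mem_Iic] at ha hb
      rcases Nat.lt_or_ge k a with h1 | h1 <;> rcases Nat.lt_or_ge k b with h2 | h2
      · lia
      · obtain rfl : a = k + 1 := by lia
        rw [key b h2, Function.update_self] at hab
        exact absurd hab.symm (hu'.1 b (by lia))
      · obtain rfl : b = k + 1 := by lia
        rw [key a h1, Function.update_self] at hab
        exact absurd hab (hu'.1 a (by lia))
      · rw [key a h1, key b h2] at hab
        exact qinj h1 h2 hab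
    · intro i hi
      rcases Nat.lt_or_ge k i with h1 | h1
      · obtain rfl : i = k + 1 := by lia
        rw [Function.update_self]
        exact ⟨hu.1, hu'.2⟩
      · rw [key i h1]
        exact qS i h1
    · intro i hi
      rw [key i (by lia)]
      rcases Nat.lt_or_ge i k with h1 | h1
      · rw [key (i + 1) (by lia)]
        exact qE i h1
      · obtain rfl : i = k := by lia
        rw [Function.update_self]
        exact hu.2

/-! ### Rainbow breadth-first trees -/

/-- A rooted tree in `G`, given by levels and parents (vertices of level above `ℓ` are not in the
tree), whose edges have distinct colours, and which is maximal: an edge of `G` leading from level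
`i < ℓ` to a level above `i + 1` has a colour that occurs in the tree up to level `i + 1`. -/
structure IsRainbowTree {U κ : Type*} (G : SimpleGraph U) (c : Sym2 U → κ) (x : U) (ℓ : ℕ)
    (lev : U → ℕ) (par : U → U) : Prop where
  lev_eq_zero : ∀ v, lev v = 0 ↔ v = x
  adj : ∀ v, 0 < lev v → lev v ≤ ℓ → G.Adj v (par v)
  lev_par : ∀ v, 0 < lev v → lev v ≤ ℓ → lev (par v) + 1 = lev v
  inj : ∀ u v, 0 < lev u → lev u ≤ ℓ → 0 < lev v → lev v ≤ ℓ →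
    c s(u, par u) = c s(v, par v) → u = v
  maximal : ∀ u v, G.Adj u v → lev u < ℓ → lev u + 1 < lev v →
    ∃ y, 0 < lev y ∧ lev y ≤ lev u + 1 ∧ c s(y, par y) = c s(u, v)

-- The tree is built one level at a time: each new level attaches a maximal set of edges to outside
-- vertices with new, distinct colours.
open Finset in
theorem exists_isRainbowTree {U κ : Type*} [Fintype U] (G : SimpleGraph U) (c : Sym2 U → κ)
    (x : U) (ℓ : ℕ) : ∃ lev par, IsRainbowTree G c x ℓ lev par := by
  classical
  induction ℓ with
  | zero =>
    refine ⟨fun v => if v = x then 0 else 1, id, ?_, ?_, ?_, ?_, ?_⟩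
    · intro v; split_ifs <;> simp_all
    · intro v h1 h2; lia
    · intro v h1 h2; lia
    · intro u v h1 h2; lia
    · intro u v _ h; lia
  | succ ℓ ih =>
    obtain ⟨lev, par, hT⟩ := ih
    -- A pair in `P` is (parent on level `ℓ`, new child).
    let good : Finset (U × U) → Prop := fun P =>
      (∀ p ∈ P, lev p.1 = ℓ ∧ ℓ < lev p.2 ∧ G.Adj p.1 p.2 ∧
        ∀ y, 0 < lev y → lev y ≤ ℓ → c s(y, par y) ≠ c s(p.1, p.2)) ∧
      (∀ p ∈ P, ∀ p' ∈ P, p.2 = p'.2 → p = p') ∧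
      (∀ p ∈ P, ∀ p' ∈ P, c s(p.1, p.2) = c s(p'.1, p'.2) → p = p')
    obtain ⟨P, hP⟩ : ∃ P, Maximal good P := by
      obtain ⟨P, -, hP⟩ := exists_maximal_ge_of_wellFoundedGT good ∅ (by simp [good])
      exact ⟨P, hP⟩
    obtain ⟨hP1, hP2, hP3⟩ := hP.1
    let new : U → Prop := fun v => ∃ u, (u, v) ∈ P
    let pr : U → U := fun v => if h : new v then h.choose else par v
    -- Vertices left outside get level `ℓ + 2`, so that an edge to them from level `ℓ` counts as
    -- skipping a level in `maximal`.
    let lv : U → ℕ := fun v => if new v then ℓ + 1 else if lev v ≤ ℓ then lev v else ℓ + 2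
    have new_lev : ∀ v, new v → ℓ < lev v := fun v ⟨u, hu⟩ => (hP1 _ hu).2.1
    have pr_new : ∀ v, new v → (pr v, v) ∈ P := fun v hv => by
      have : pr v = hv.choose := dif_pos hv
      rw [this]; exact hv.choose_spec
    have pr_old : ∀ v, ¬ new v → pr v = par v := fun v hv => dif_neg hv
    have lv_new : ∀ v, new v → lv v = ℓ + 1 := fun v hv => if_pos hv
    have lv_old : ∀ v, lev v ≤ ℓ → lv v = lev v := fun v hv => by
      have : ¬ new v := fun h => by have := new_lev v h; lia
      simp only [lv, if_neg this, if_pos hv]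
    have lv_out : ∀ v, ¬ new v → ℓ < lev v → lv v = ℓ + 2 := fun v hv h => by
      simp only [lv, if_neg hv, if_neg (Nat.not_le.2 h)]
    have old_not_new : ∀ v, lev v ≤ ℓ → ¬ new v := fun v hv h => by
      have := new_lev v h; lia
    have lv_cases : ∀ v, (new v ∧ lv v = ℓ + 1) ∨ (¬ new v ∧ lev v ≤ ℓ ∧ lv v = lev v) ∨
        (¬ new v ∧ ℓ < lev v ∧ lv v = ℓ + 2) := by
      intro v
      by_cases h : new v
      · exact Or.inl ⟨h, lv_new v h⟩
      · rcases Nat.lt_or_ge ℓ (lev v) with h' | h'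
        · exact Or.inr (Or.inr ⟨h, h', lv_out v h h'⟩)
        · exact Or.inr (Or.inl ⟨h, h', lv_old v h'⟩)
    refine ⟨lv, pr, ?_, ?_, ?_, ?_, ?_⟩
    · intro v
      rw [← hT.lev_eq_zero v]
      rcases lv_cases v with ⟨h, h'⟩ | ⟨h, h1, h2⟩ | ⟨h, h1, h2⟩
      · have := new_lev v h; lia
      · lia
      · lia
    · intro v h0 hl
      rcases lv_cases v with ⟨h, h'⟩ | ⟨h, h1, h2⟩ | ⟨h, h1, h2⟩
      · exact (hP1 _ (pr_new v h)).2.2.1.symm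
      · rw [pr_old v h]; exact hT.adj v (by lia) h1
      · lia
    · intro v h0 hl
      rcases lv_cases v with ⟨h, h'⟩ | ⟨h, h1, h2⟩ | ⟨h, h1, h2⟩
      · have := (hP1 _ (pr_new v h)).1
        simp only at this
        rw [lv_old _ this.le, this, h']
      · have := hT.lev_par v (by lia) h1
        rw [pr_old v h, lv_old (par v) (by lia), h2, this]
      · lia
    · intro u v hu hu' hv hv' heq
      rcases lv_cases u with ⟨h, h'⟩ | ⟨h, h1, h2⟩ | ⟨h, h1, h2⟩
      · rcases lv_cases v with ⟨k, k'⟩ | ⟨k, k1, k2⟩ | ⟨k, k1, k2⟩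
        · have := hP3 _ (pr_new u h) _ (pr_new v k)
            (by simpa [Sym2.eq_swap] using heq)
          exact (Prod.ext_iff.1 this).2
        · rw [pr_old v k] at heq
          refine absurd ?_ ((hP1 _ (pr_new u h)).2.2.2 v (by lia) k1)
          rw [← heq, Sym2.eq_swap]
        · lia
      · rcases lv_cases v with ⟨k, k'⟩ | ⟨k, k1, k2⟩ | ⟨k, k1, k2⟩
        · rw [pr_old u h] at heq
          refine absurd ?_ ((hP1 _ (pr_new v k)).2.2.2 u (by lia) h1)
          rw [heq, Sym2.eq_swap]
        · rw [pr_old u h, pr_old v k] at heq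
          exact hT.inj u v (by lia) h1 (by lia) k1 heq
        · lia
      · lia
    · intro u v hadj hu huv
      have hlu : lev u ≤ ℓ ∧ lv u = lev u := by
        rcases lv_cases u with ⟨h, h'⟩ | ⟨h, h1, h2⟩ | ⟨h, h1, h2⟩
        · lia
        · exact ⟨h1, h2⟩
        · lia
      have old : ∀ y, 0 < lev y → lev y ≤ ℓ → lev y ≤ lev u + 1 →
          c s(y, par y) = c s(u, v) →
          ∃ y, 0 < lv y ∧ lv y ≤ lv u + 1 ∧ c s(y, pr y) = c s(u, v) := by
        intro y h1 h2 h3 h4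
        refine ⟨y, ?_, ?_, ?_⟩
        · rw [lv_old y h2]; exact h1
        · rw [lv_old y h2]; lia
        · rw [pr_old y (old_not_new y h2)]; exact h4
      rcases Nat.lt_or_ge (lev u) ℓ with h | h
      · have hv : lev u + 1 < lev v := by
          rcases lv_cases v with ⟨k, k'⟩ | ⟨k, k1, k2⟩ | ⟨k, k1, k2⟩
          · have := new_lev v k; lia
          · lia
          · lia
        obtain ⟨y, h1, h2, h3⟩ := hT.maximal u v hadj h hv
        exact old y h1 (by lia) h2 h3
      · have hlu' : lev u = ℓ := by lia
        have hv : ¬ new v ∧ ℓ < lev v := by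
          rcases lv_cases v with ⟨k, k'⟩ | ⟨k, k1, k2⟩ | ⟨k, k1, k2⟩
          · lia
          · lia
          · exact ⟨k, k1⟩
        -- If the colour of `uv` did not occur in the new tree, `(u, v)` could be added to `P`,
        -- against its maximality.
        by_contra hcon
        have hmem : (u, v) ∈ P := by
          refine hP.2 (y := insert (u, v) P) ⟨?_, ?_, ?_⟩ (subset_insert _ _)
            (mem_insert_self _ _)
          · intro p hp
            rcases mem_insert.1 hp with rfl | hp
            · refine ⟨hlu', hv.2, hadj, fun y h1 h2 h3 => hcon ?_⟩
              exact old y h1 h2 (by lia) h3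
            · exact hP1 p hp
          · intro p hp p' hp' heq
            rcases mem_insert.1 hp with rfl | hp <;> rcases mem_insert.1 hp' with rfl | hp'
            · rfl
            · exact absurd ⟨p'.1, by simp only at heq; rw [heq]; exact hp'⟩ hv.1
            · exact absurd ⟨p.1, by simp only at heq; rw [← heq]; exact hp⟩ hv.1
            · exact hP2 p hp p' hp' heq
          · have aux : ∀ p ∈ P, c s(p.1, p.2) ≠ c s(u, v) := by
              intro p hp heq
              have hnp : new p.2 := ⟨p.1, hp⟩
              have h5 := hP2 _ (pr_new p.2 hnp) _ hp rfl
              refine hcon ⟨p.2, by rw [lv_new _ hnp]; lia, by rw [lv_new _ hnp]; lia, ?_⟩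
              rw [← heq, ← (Prod.ext_iff.1 h5).1, Sym2.eq_swap]
            intro p hp p' hp' heq
            rcases mem_insert.1 hp with rfl | hp <;> rcases mem_insert.1 hp' with rfl | hp'
            · rfl
            · exact absurd heq.symm (aux p' hp')
            · exact absurd heq (aux p hp)
            · exact hP3 p hp p' hp' heq
        exact hv.1 ⟨u, hmem⟩

/-! ### Rainbow cycles from a tree and a path -/

/-- `f 0, f 1, …, f N = f 0` is a cycle of `G` whose edges have distinct colours. -/
structure IsRainbowCycle {U κ : Type*} (G : SimpleGraph U) (c : Sym2 U → κ) (N : ℕ)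
    (f : ℕ → U) : Prop where
  inj : Set.InjOn f (Set.Iio N)
  closed : f N = f 0
  adj : ∀ i < N, G.Adj (f i) (f (i + 1))
  rainbow : Set.InjOn (fun i => c s(f i, f (i + 1))) (Set.Iio N)

theorem IsRainbowCycle.exists_embedding {U κ : Type*} {G : SimpleGraph U} {c : Sym2 U → κ} {N : ℕ}
    {f : ℕ → U} (hf : IsRainbowCycle G c N f) (hN : 2 ≤ N) :
    ∃ g : Fin N ↪ U, (∀ e ∈ (SimpleGraph.cycleGraph N).edgeSet, Sym2.map g e ∈ G.edgeSet) ∧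
      Set.InjOn (fun e => c (Sym2.map g e)) (SimpleGraph.cycleGraph N).edgeSet := by
  obtain ⟨N, rfl⟩ : ∃ M, N = M + 2 := ⟨N - 2, by lia⟩
  have hsucc : ∀ i : Fin (N + 2), f ((i + 1 : Fin (N + 2)) : ℕ) = f (i + 1) := by
    intro i
    rw [Fin.val_add_one]
    split_ifs with h
    · rw [h, ← hf.closed]; rfl
    · rfl
  have hedge : ∀ e ∈ (SimpleGraph.cycleGraph (N + 2)).edgeSet, ∃ i : Fin (N + 2),
      e = s(i, i + 1) := by
    intro e he
    induction e with
    | _ a b =>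
      rw [SimpleGraph.mem_edgeSet, SimpleGraph.cycleGraph_adj] at he
      rcases he with h | h
      · exact ⟨b, by rw [Sym2.eq_swap, ← h, add_sub_cancel]⟩
      · exact ⟨a, by rw [← h, add_sub_cancel]⟩
  refine ⟨⟨fun i => f i, fun i j h => Fin.ext (hf.inj i.2 j.2 h)⟩, ?_, ?_⟩
  · intro e he
    obtain ⟨i, rfl⟩ := hedge e he
    change G.Adj (f i) (f ((i + 1 : Fin (N + 2)) : ℕ))
    rw [hsucc]
    exact hf.adj i i.2
  · intro e he e' he' heq
    obtain ⟨i, rfl⟩ := hedge e he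
    obtain ⟨j, rfl⟩ := hedge e' he'
    change c s(f i, f ((i + 1 : Fin (N + 2)) : ℕ)) = c s(f j, f ((j + 1 : Fin (N + 2)) : ℕ)) at heq
    rw [hsucc, hsucc] at heq
    rw [Fin.ext (hf.rainbow i.2 j.2 heq)]

section

variable {U κ : Type*} {G : SimpleGraph U} {c : Sym2 U → κ} {x : U} {ℓ : ℕ} {lev : U → ℕ}
  {par : U → U}

theorem IsRainbowTree.lev_iterate_par (hT : IsRainbowTree G c x ℓ lev par) (v : U)
    (hv : lev v ≤ ℓ) (a : ℕ) (ha : a ≤ lev v) : lev (par^[a] v) + a = lev v := by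
  induction a with
  | zero => rfl
  | succ a ih =>
    have h1 := ih (by lia)
    rw [Function.iterate_succ_apply']
    have h2 := hT.lev_par (par^[a] v) (by lia) (by lia)
    lia

theorem IsRainbowTree.iterate_par_lev (hT : IsRainbowTree G c x ℓ lev par) (v : U)
    (hv : lev v ≤ ℓ) : par^[lev v] v = x := by
  have h := hT.lev_iterate_par v hv (lev v) le_rfl
  exact (hT.lev_eq_zero _).1 (by lia)

/-- Two vertices of level `j` of a rainbow tree, whose branches meet `h + 1` levels below, together
with a rainbow path `q` above level `j` joining them yield a rainbow cycle. -/
theorem IsRainbowTree.exists_isRainbowCycle_of_path (hT : IsRainbowTree G c x ℓ lev par) {j : ℕ}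
    (hj : j ≤ ℓ) {m h : ℕ} (q : ℕ → U) (hq : Set.InjOn q (Set.Iic m))
    (hlev : ∀ i ≤ m, j ≤ lev (q i)) (hadj : ∀ i < m, G.Adj (q i) (q (i + 1)))
    (hrb : Set.InjOn (fun i => c s(q i, q (i + 1))) (Set.Iio m))
    (havoid : ∀ i < m, ∀ y, 0 < lev y → lev y ≤ j → c s(y, par y) ≠ c s(q i, q (i + 1)))
    (h0 : lev (q 0) = j) (hm : lev (q m) = j) (hhj : h + 1 ≤ j)
    (heq : par^[h + 1] (q 0) = par^[h + 1] (q m)) (hne : par^[h] (q 0) ≠ par^[h] (q m)) :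
    ∃ f, IsRainbowCycle G c (m + 2 * (h + 1)) f := by
  have l0 : ∀ a ≤ h + 1, lev (par^[a] (q 0)) + a = j := fun a ha => by
    rw [hT.lev_iterate_par _ (by lia) a (by lia), h0]
  have lm : ∀ a ≤ h + 1, lev (par^[a] (q m)) + a = j := fun a ha => by
    rw [hT.lev_iterate_par _ (by lia) a (by lia), hm]
  have hdiff : ∀ a ≤ h, par^[a] (q 0) ≠ par^[a] (q m) := by
    intro a ha hcon
    apply hne
    obtain ⟨b, rfl⟩ := Nat.exists_eq_add_of_le ha
    rw [Nat.add_comm, Function.iterate_add_apply, Function.iterate_add_apply, hcon]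
  -- Along the path to `q m`, down the tree to the common ancestor, and back up the other branch to
  -- `q 0`. Past the endpoints the branches lie strictly below level `j`, hence off the path.
  let f : ℕ → U := fun i => if i ≤ m then q i else if i ≤ m + (h + 1) then par^[i - m] (q m) else
    par^[m + 2 * (h + 1) - i] (q 0)
  have f1 : ∀ i ≤ m, f i = q i := fun i hi => if_pos hi
  have f2 : ∀ a ≤ h + 1, f (m + a) = par^[a] (q m) := by
    intro a ha
    rcases Nat.eq_zero_or_pos a with rfl | ha'
    · exact f1 _ le_rfl
    · simp only [f]
      rw [if_neg (by lia), if_pos (by lia), Nat.add_sub_cancel_left]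
  have f3 : ∀ a ≤ h + 1, f (m + 2 * (h + 1) - a) = par^[a] (q 0) := by
    intro a ha
    rcases Nat.lt_or_ge a (h + 1) with ha' | ha'
    · simp only [f]
      rw [if_neg (by lia), if_neg (by lia)]
      congr 1
      lia
    · obtain rfl : a = h + 1 := by lia
      rw [heq, ← f2 _ le_rfl]
      congr 1
      lia
  have cases3 : ∀ i < m + 2 * (h + 1), i ≤ m ∨ (∃ a, 0 < a ∧ a ≤ h + 1 ∧ i = m + a) ∨
      ∃ a, 0 < a ∧ a ≤ h ∧ i = m + 2 * (h + 1) - a := by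
    intro i hi
    by_cases h1 : i ≤ m
    · exact Or.inl h1
    · by_cases h2 : i ≤ m + (h + 1)
      · exact Or.inr (Or.inl ⟨i - m, by lia, by lia, by lia⟩)
      · exact Or.inr (Or.inr ⟨m + 2 * (h + 1) - i, by lia, by lia, by lia⟩)
  -- the tree vertex whose parent edge is the `i`-th edge
  have edge : ∀ i < m + 2 * (h + 1), i < m ∨
      (∃ a ≤ h, i = m + a ∧ s(f i, f (i + 1)) = s(par^[a] (q m), par (par^[a] (q m)))) ∨
      ∃ a ≤ h, i = m + 2 * (h + 1) - (a + 1) ∧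
        s(f i, f (i + 1)) = s(par^[a] (q 0), par (par^[a] (q 0))) := by
    intro i hi
    by_cases h1 : i < m
    · exact Or.inl h1
    · by_cases h2 : i < m + (h + 1)
      · refine Or.inr (Or.inl ⟨i - m, by lia, by lia, ?_⟩)
        obtain ⟨a, rfl⟩ := Nat.exists_eq_add_of_le (Nat.le_of_not_lt h1)
        rw [f2 a (by lia), Nat.add_assoc, f2 (a + 1) (by lia), Nat.add_sub_cancel_left,
          Function.iterate_succ_apply']
      · refine Or.inr (Or.inr ⟨m + 2 * (h + 1) - i - 1, by lia, by lia, ?_⟩)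
        have e1 := f3 (m + 2 * (h + 1) - i - 1) (by lia)
        have e2 := f3 (m + 2 * (h + 1) - i - 1 + 1) (by lia)
        rw [show m + 2 * (h + 1) - (m + 2 * (h + 1) - i - 1) = i + 1 by lia] at e1
        rw [show m + 2 * (h + 1) - (m + 2 * (h + 1) - i - 1 + 1) = i by lia,
          Function.iterate_succ_apply'] at e2
        rw [e1, e2, Sym2.eq_swap]
  have treeinj : ∀ u v : U, 0 < lev u → lev u ≤ j → 0 < lev v → lev v ≤ j →
      c s(u, par u) = c s(v, par v) → u = v := fun u v h1 h2 h3 h4 =>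
    hT.inj u v h1 (by lia) h3 (by lia)
  have hpath : ∀ i < m, s(f i, f (i + 1)) = s(q i, q (i + 1)) := fun i hi => by
    rw [f1 i (by lia), f1 (i + 1) (by lia)]
  refine ⟨f, ?_, ?_, ?_, ?_⟩
  · intro i hi i' hi' hii
    rcases cases3 i hi with h1 | ⟨a, a0, ha, rfl⟩ | ⟨a, a0, ha, rfl⟩ <;>
      rcases cases3 i' hi' with h2 | ⟨b, b0, hb, rfl⟩ | ⟨b, b0, hb, rfl⟩
    · rw [f1 i h1, f1 i' h2] at hii
      exact hq h1 h2 hii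
    · rw [f1 i h1, f2 b hb] at hii
      have := lm b hb; have := hlev i h1; rw [hii] at this; lia
    · rw [f1 i h1, f3 b (by lia)] at hii
      have := l0 b (by lia); have := hlev i h1; rw [hii] at this; lia
    · rw [f1 i' h2, f2 a ha] at hii
      have := lm a ha; have := hlev i' h2; rw [← hii] at this; lia
    · rw [f2 a ha, f2 b hb] at hii
      have h5 := lm a ha; have := lm b hb; rw [hii] at h5; lia
    · rw [f2 a ha, f3 b (by lia)] at hii
      have h5 := lm a ha; have := l0 b (by lia); rw [hii] at h5
      obtain rfl : a = b := by lia
      exact absurd hii.symm (hdiff a hb)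
    · rw [f1 i' h2, f3 a (by lia)] at hii
      have := l0 a (by lia); have := hlev i' h2; rw [← hii] at this; lia
    · rw [f3 a (by lia), f2 b hb] at hii
      have h5 := l0 a (by lia); have := lm b hb; rw [hii] at h5
      obtain rfl : a = b := by lia
      exact absurd hii (hdiff a ha)
    · rw [f3 a (by lia), f3 b (by lia)] at hii
      have h5 := l0 a (by lia); have := l0 b (by lia); rw [hii] at h5; lia
  · have := f3 0 (by lia)
    rw [f1 0 (by lia)]
    simpa using this
  · intro i hi
    rw [← SimpleGraph.mem_edgeSet]
    rcases edge i hi with h1 | ⟨a, ha, rfl, h1⟩ | ⟨a, ha, rfl, h1⟩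
    · rw [hpath i h1]; exact hadj i h1
    · rw [h1]
      have := lm a (by lia)
      exact hT.adj _ (by lia) (by lia)
    · rw [h1]
      have := l0 a (by lia)
      exact hT.adj _ (by lia) (by lia)
  · intro i hi i' hi' hii
    simp only at hii
    rcases edge i hi with h1 | ⟨a, ha, rfl, h1⟩ | ⟨a, ha, rfl, h1⟩ <;>
      rcases edge i' hi' with h2 | ⟨b, hb, rfl, h2⟩ | ⟨b, hb, rfl, h2⟩
    · rw [hpath i h1, hpath i' h2] at hii
      exact hrb h1 h2 hii
    · rw [hpath i h1, h2] at hii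
      have := lm b (by lia)
      exact absurd hii.symm (havoid i h1 _ (by lia) (by lia))
    · rw [hpath i h1, h2] at hii
      have := l0 b (by lia)
      exact absurd hii.symm (havoid i h1 _ (by lia) (by lia))
    · rw [hpath i' h2, h1] at hii
      have := lm a (by lia)
      exact absurd hii (havoid i' h2 _ (by lia) (by lia))
    · rw [h1, h2] at hii
      have h5 := lm a (by lia); have h6 := lm b (by lia)
      rw [treeinj _ _ (by lia) (by lia) (by lia) (by lia) hii] at h5; lia
    · rw [h1, h2] at hii
      have h5 := lm a (by lia); have h6 := l0 b (by lia)
      have h7 := treeinj _ _ (by lia) (by lia) (by lia) (by lia) hii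
      rw [h7] at h5
      obtain rfl : a = b := by lia
      exact absurd h7.symm (hdiff a ha)
    · rw [hpath i' h2, h1] at hii
      have := l0 a (by lia)
      exact absurd hii (havoid i' h2 _ (by lia) (by lia))
    · rw [h1, h2] at hii
      have h5 := l0 a (by lia); have h6 := lm b (by lia)
      have h7 := treeinj _ _ (by lia) (by lia) (by lia) (by lia) hii
      rw [h7] at h5
      obtain rfl : a = b := by lia
      exact absurd h7 (hdiff a ha)
    · rw [h1, h2] at hii
      have h5 := l0 a (by lia); have h6 := l0 b (by lia)
      rw [treeinj _ _ (by lia) (by lia) (by lia) (by lia) hii] at h5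
      obtain rfl : a = b := by lia
      rfl

/-- The set `E` consists of edges of `G` with distinct colours that do not occur in the tree up to
level `J`. -/
structure IsFresh (G : SimpleGraph U) (c : Sym2 U → κ) (lev : U → ℕ) (par : U → U) (J : ℕ)
    (E : Finset (Sym2 U)) : Prop where
  subset : ∀ e ∈ E, e ∈ G.edgeSet
  inj : Set.InjOn c E
  avoid : ∀ e ∈ E, ∀ y, 0 < lev y → lev y ≤ J → c s(y, par y) ≠ c e

/-- As `IsRainbowTree.exists_isRainbowCycle_of_path`, for a path with vertices
`z, q 0, q 1, …, q k` and fresh edges. -/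
theorem IsRainbowTree.exists_isRainbowCycle_of_cons (hT : IsRainbowTree G c x ℓ lev par) {j : ℕ}
    (hj : j ≤ ℓ) {E : Finset (Sym2 U)} (hE : IsFresh G c lev par j E) {k h : ℕ}
    (z : U) (q : ℕ → U) (hq : Set.InjOn q (Set.Iic k)) (hqE : ∀ i < k, s(q i, q (i + 1)) ∈ E)
    (hqz : ∀ i ≤ k, q i ≠ z) (hzE : s(z, q 0) ∈ E) (hlev : ∀ i ≤ k, j ≤ lev (q i))
    (hz : lev z = j) (hk : lev (q k) = j) (hhj : h + 1 ≤ j)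
    (heq : par^[h + 1] z = par^[h + 1] (q k)) (hne : par^[h] z ≠ par^[h] (q k)) :
    ∃ f, IsRainbowCycle G c (k + 1 + 2 * (h + 1)) f := by
  let r : ℕ → U := fun i => Nat.casesOn i z q
  have rinj : Set.InjOn r (Set.Iic (k + 1)) := by
    intro a ha b hb hab
    simp only [Set.mem_Iic] at ha hb
    rcases a with _ | a <;> rcases b with _ | b
    · rfl
    · exact absurd hab.symm (hqz b (by lia))
    · exact absurd hab (hqz a (by lia))
    · rw [hq (show a ∈ Set.Iic k by simp; lia) (show b ∈ Set.Iic k by simp; lia) hab]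
  have rE : ∀ i < k + 1, s(r i, r (i + 1)) ∈ E := by
    intro i hi
    rcases i with _ | i
    · exact hzE
    · exact hqE i (by lia)
  refine hT.exists_isRainbowCycle_of_path hj r rinj ?_ (fun i hi => hE.subset _ (rE i hi)) ?_
    (fun i hi => hE.avoid _ (rE i hi)) hz hk hhj heq hne
  · intro i hi
    rcases i with _ | i
    · exact hz.ge
    · exact hlev i (by lia)
  · intro a ha b hb hab
    simp only [Set.mem_Iio] at ha hb
    have h1 := hE.inj (rE a ha) (rE b hb) hab
    have mem : ∀ i ≤ k + 1, i ∈ Set.Iic (k + 1) := fun i hi => hi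
    -- If two edges of the path coincide with reversed orientation, then `a = b + 1` and `a + 1 =
    -- b`, which is absurd.
    rcases Sym2.eq_iff.1 h1 with ⟨h2, -⟩ | ⟨h2, h3⟩
    · exact rinj (mem a (by lia)) (mem b (by lia)) h2
    · have := rinj (mem a (by lia)) (mem (b + 1) (by lia)) h2
      have := rinj (mem (a + 1) (by lia)) (mem b (by lia)) h3
      lia

end

/-! ### Dense sets of fresh edges force rainbow cycles -/

section

variable {U κ : Type*} {G : SimpleGraph U} {c : Sym2 U → κ} {x : U} {ℓ : ℕ} {lev : U → ℕ}
  {par : U → U}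

-- The end of a path from `p` cannot have the same `h`-th ancestor as both `a` and `b`. Prepending
-- one whose ancestor differs gives a path whose end branches meet exactly `h + 1` levels down. The
-- path must avoid both vertices, hence `k + 2 ≤ D`.
open Finset in
theorem IsRainbowTree.exists_isRainbowCycle_of_common_neighbor [DecidableEq U]
    (hT : IsRainbowTree G c x ℓ lev par) {j : ℕ} (hj : j ≤ ℓ) {E : Finset (Sym2 U)}
    (hE : IsFresh G c lev par j E) {S : Finset U} {D : ℕ}
    (hdeg : ∀ v ∈ S, D < #{u ∈ S | s(v, u) ∈ E}) {k h : ℕ} (hk : k + 2 ≤ D) (hhj : h + 1 ≤ j)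
    {p a b : U} (hp : p ∈ S) (ha : s(a, p) ∈ E) (hb : s(b, p) ∈ E)
    (hla : lev a = j) (hlb : lev b = j) (hab : par^[h] a ≠ par^[h] b)
    (hab' : par^[h + 1] a = par^[h + 1] b)
    (hpath : ∀ q : ℕ → U, q 0 = p → (∀ i < k, s(q i, q (i + 1)) ∈ E) → (∀ i ≤ k, q i ∈ S) →
      (∀ i ≤ k, j ≤ lev (q i)) ∧ lev (q k) = j ∧ par^[h + 1] a = par^[h + 1] (q k)) :
    ∃ f, IsRainbowCycle G c (k + 1 + 2 * (h + 1)) f := by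
  have hne : ∀ u, s(u, p) ∈ E → p ≠ u := fun u hu h => by
    have := hE.subset _ hu
    rw [h, SimpleGraph.mem_edgeSet] at this
    exact this.ne rfl
  obtain ⟨q, q0, qinj, qS, qE⟩ := exists_path_avoiding E S D hdeg {a, b} p hp
    (by simp [hne a ha, hne b hb]) k
    (by have := card_le_two (a := a) (b := b); lia)
  obtain ⟨h1, h2, h3⟩ := hpath q q0 qE fun i hi => (qS i hi).1
  simp only [mem_insert, mem_singleton, not_or] at qS
  by_cases hc : par^[h] a = par^[h] (q k)
  · exact hT.exists_isRainbowCycle_of_cons hj hE b q qinj qE (fun i hi => (qS i hi).2.2)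
      (by rw [q0]; exact hb) h1 hlb h2 hhj (hab'.symm.trans h3) (fun h => hab (hc.trans h.symm))
  · exact hT.exists_isRainbowCycle_of_cons hj hE a q qinj qE (fun i hi => (qS i hi).2.1)
      (by rw [q0]; exact ha) h1 hla h2 hhj h3 hc

open Finset in
/-- A dense set of fresh edges inside the levels of a rainbow tree yields a rainbow cycle of any
odd length that is at least `2J + 1`. -/
theorem IsRainbowTree.exists_odd_isRainbowCycle [DecidableEq U]
    (hT : IsRainbowTree G c x ℓ lev par) {J : ℕ} (hJ : J ≤ ℓ) {E : Finset (Sym2 U)}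
    (hE : IsFresh G c lev par J E) {S : Finset U} (hS : S.Nonempty) (hSJ : ∀ v ∈ S, lev v ≤ J)
    (hdeg : ∀ v ∈ S, 2 * ℓ < #{u ∈ S | s(v, u) ∈ E})
    (hlevE : ∀ u v, s(u, v) ∈ E → lev u = lev v) :
    ∃ f, IsRainbowCycle G c (2 * ℓ + 1) f := by
  classical
  obtain ⟨v₀, hv₀⟩ := hS
  obtain ⟨j, hj⟩ : ∃ j, lev v₀ = j := ⟨_, rfl⟩
  have hjJ : j ≤ J := hj ▸ hSJ v₀ hv₀
  have hEj : IsFresh G c lev par j E :=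
    ⟨hE.subset, hE.inj, fun e he y h1 h2 => hE.avoid e he y h1 (by lia)⟩
  have hPj : ∀ a b, a ∈ S → b ∈ S → lev a = j → s(a, b) ∈ E → par^[j] a = par^[j] b := by
    intro a b _ _ ha hab
    have h1 := hT.iterate_par_lev a (by lia)
    have h2 := hT.iterate_par_lev b (by rw [← hlevE a b hab]; lia)
    rw [← hlevE a b hab] at h2
    rw [← ha, h1, h2]
  -- The least such `t` is `h + 1`: ancestors at distance `h + 1` agree along every edge considered,
  -- while those at distance `h` differ along some edge `ab`. This fixes the tree part of the cycle
  -- at `2(h + 1)` edges.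
  have hP : ∃ t, ∀ a b, a ∈ S → b ∈ S → lev a = j → s(a, b) ∈ E → par^[t] a = par^[t] b :=
    ⟨j, hPj⟩
  have hnbr : ∃ b ∈ S, s(v₀, b) ∈ E := by
    have h1 := hdeg v₀ hv₀
    obtain ⟨b, hb⟩ := card_pos.1 (Nat.zero_lt_of_lt h1)
    exact ⟨b, (mem_filter.1 hb).1, (mem_filter.1 hb).2⟩
  have hloop : ∀ u v, s(u, v) ∈ E → u ≠ v := fun u v hu h => by
    have := hE.subset _ hu
    rw [h, SimpleGraph.mem_edgeSet] at this
    exact this.ne rfl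
  have hfj : Nat.find hP ≤ j := Nat.find_min' hP hPj
  obtain ⟨h, hh⟩ : ∃ h, Nat.find hP = h + 1 := by
    refine Nat.exists_eq_succ_of_ne_zero fun h0 => ?_
    obtain ⟨b, hb, hb'⟩ := hnbr
    have := Nat.find_spec hP v₀ b hv₀ hb hj hb'
    rw [h0] at this
    exact hloop _ _ hb' this
  have hspec := Nat.find_spec hP
  have hmin := Nat.find_min hP (m := h) (by lia)
  rw [hh] at hspec hfj
  push Not at hmin
  obtain ⟨a, b, ha, hb, haj, habE, hab⟩ := hmin
  have hbj : lev b = j := by rw [← hlevE a b habE, haj]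
  obtain ⟨k, hk⟩ : ∃ k, 2 * ℓ + 1 = 2 * k + 1 + 2 * (h + 1) := ⟨ℓ - (h + 1), by lia⟩
  rw [hk]
  have walk : ∀ q : ℕ → U, lev (q 0) = j → (∀ i < 2 * k, s(q i, q (i + 1)) ∈ E) →
      (∀ i ≤ 2 * k, q i ∈ S) →
      ∀ i ≤ 2 * k, lev (q i) = j ∧ par^[h + 1] (q 0) = par^[h + 1] (q i) := by
    intro q q0 qE qS i hi
    induction i with
    | zero => exact ⟨q0, rfl⟩
    | succ i ih =>
      obtain ⟨h1, h2⟩ := ih (by lia)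
      refine ⟨by rw [← hlevE _ _ (qE i (by lia)), h1], h2.trans ?_⟩
      exact hspec _ _ (qS i (by lia)) (qS _ hi) h1 (qE i (by lia))
  -- Either some vertex has two neighbours with distinct `h`-th ancestors, or all neighbours of each
  -- vertex on level `j` agree.
  by_cases hcn : ∃ p u v, p ∈ S ∧ u ∈ S ∧ v ∈ S ∧ lev u = j ∧ s(u, p) ∈ E ∧ s(v, p) ∈ E ∧
      par^[h] u ≠ par^[h] v
  · obtain ⟨p, u, v, hp, hu, hv, huj, hup, hvp, huv⟩ := hcn
    have hpj : lev p = j := by rw [← hlevE _ _ hup, huj]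
    have hvj : lev v = j := by rw [hlevE _ _ hvp, hpj]
    have hup' := hspec u p hu hp huj hup
    have hvp' := hspec v p hv hp hvj hvp
    refine hT.exists_isRainbowCycle_of_common_neighbor (by lia) hEj hdeg (by lia) hfj hp
      hup hvp huj hvj huv (hup'.trans hvp'.symm) fun q q0 qE qS => ?_
    have := walk q (by rw [q0, hpj]) qE qS
    refine ⟨fun i hi => (this i hi).1.ge, (this _ le_rfl).1, hup'.trans ?_⟩
    rw [← q0]
    exact (this _ le_rfl).2
  -- Now `h`-th ancestors are constant along every second vertex of a path, so an even path from `b`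
  -- ends in the branch of `b`, which differs from that of `a`.
  · push Not at hcn
    obtain ⟨q, q0, qinj, qS, qE⟩ := exists_path_avoiding E S (2 * ℓ) hdeg {a} b hb
      (by simpa using (hloop a b habE).symm) (2 * k) (by rw [card_singleton]; lia)
    simp only [mem_singleton] at qS
    have hw := walk q (by rw [q0, hbj]) qE fun i hi => (qS i hi).1
    have halt : ∀ i ≤ k, par^[h] (q 0) = par^[h] (q (2 * i)) := by
      intro i hi
      induction i with
      | zero => rfl
      | succ i ih =>
        refine (ih (by lia)).trans ?_
        refine hcn (q (2 * i + 1)) _ _ (qS _ (by lia)).1 (qS _ (by lia)).1 (qS _ (by lia)).1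
          (hw _ (by lia)).1 (qE _ (by lia)) ?_
        rw [Sym2.eq_swap]
        exact qE (2 * i + 1) (by lia)
    refine hT.exists_isRainbowCycle_of_cons (by lia) hEj a q qinj qE
      (fun i hi => (qS i hi).2) (by rw [q0]; exact habE) (fun i hi => (hw i hi).1.ge) haj
      (hw _ le_rfl).1 hfj ?_ ?_
    · rw [← (hw _ le_rfl).2, q0]
      exact hspec a b ha hb haj habE
    · rw [← halt k le_rfl, q0]
      exact hab

open Finset in
/-- A dense set of fresh edges in which every path alternates between level `j` and a set `Q` of
vertices at level at least `j` yields rainbow even cycles. -/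
theorem IsRainbowTree.exists_even_isRainbowCycle [DecidableEq U]
    (hT : IsRainbowTree G c x ℓ lev par) {j : ℕ} (hj : j < ℓ) {E : Finset (Sym2 U)}
    (hE : IsFresh G c lev par j E) {S : Finset U}
    (hdeg : ∀ v ∈ S, 2 * ℓ < #{u ∈ S | s(v, u) ∈ E}) (Q : U → Prop)
    (hQlev : ∀ p, Q p → j ≤ lev p) (hQ : ∀ p v, Q p → s(p, v) ∈ E → lev v = j)
    (hQ' : ∀ v p, lev v = j → s(v, p) ∈ E → Q p) (hS : ∃ p ∈ S, Q p) :
    ∃ f, IsRainbowCycle G c (2 * ℓ) f := by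
  classical
  obtain ⟨p₀, hp₀, hp₀Q⟩ := hS
  have hPj : ∀ p u v, p ∈ S → u ∈ S → v ∈ S → Q p → s(p, u) ∈ E → s(p, v) ∈ E →
      par^[j] u = par^[j] v := by
    intro p u v _ _ _ hp hu hv
    have h1 := hQ p u hp hu
    have h2 := hQ p v hp hv
    have h3 := hT.iterate_par_lev u (by lia)
    have h4 := hT.iterate_par_lev v (by lia)
    rw [h1] at h3
    rw [h2] at h4
    rw [h3, h4]
  -- Again the least `t` is `h + 1`, now comparing level-`j` vertices with a common neighbour in
  -- `Q`.
  have hP : ∃ t, ∀ p u v, p ∈ S → u ∈ S → v ∈ S → Q p → s(p, u) ∈ E → s(p, v) ∈ E →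
      par^[t] u = par^[t] v := ⟨j, hPj⟩
  have hfj : Nat.find hP ≤ j := Nat.find_min' hP hPj
  obtain ⟨h, hh⟩ : ∃ h, Nat.find hP = h + 1 := by
    refine Nat.exists_eq_succ_of_ne_zero fun h0 => ?_
    have h1 := hdeg p₀ hp₀
    obtain ⟨u, hu, v, hv, huv⟩ := one_lt_card.1 (show 1 < #{u ∈ S | s(p₀, u) ∈ E} by lia)
    rw [mem_filter] at hu hv
    have := Nat.find_spec hP p₀ u v hp₀ hu.1 hv.1 hp₀Q hu.2 hv.2
    rw [h0] at this
    exact huv this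
  have hspec := Nat.find_spec hP
  have hmin := Nat.find_min hP (m := h) (by lia)
  rw [hh] at hspec hfj
  push Not at hmin
  obtain ⟨p, u, v, hp, hu, hv, hpQ, hpu, hpv, huv⟩ := hmin
  -- Here `h + 2 ≤ ℓ` is needed, which is why `j < ℓ` is assumed. The path from `p` has odd length
  -- `2k + 1`, so it ends on level `j`.
  obtain ⟨k, hk⟩ : ∃ k, 2 * ℓ = 2 * k + 1 + 1 + 2 * (h + 1) := ⟨ℓ - (h + 2), by lia⟩
  rw [hk]
  refine hT.exists_isRainbowCycle_of_common_neighbor (by lia) hE hdeg (by lia) hfj hp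
    (Sym2.eq_swap ▸ hpu) (Sym2.eq_swap ▸ hpv) (hQ p u hpQ hpu) (hQ p v hpQ hpv) huv
    (hspec p u v hp hu hv hpQ hpu hpv) fun q q0 qE qS => ?_
  have walk : ∀ i ≤ k, Q (q (2 * i)) ∧ lev (q (2 * i + 1)) = j ∧
      par^[h + 1] u = par^[h + 1] (q (2 * i + 1)) := by
    intro i hi
    induction i with
    | zero =>
      have hQ0 : Q (q 0) := by rw [q0]; exact hpQ
      have hq := qE 0 (by lia)
      refine ⟨hQ0, hQ _ _ hQ0 hq, ?_⟩
      rw [q0] at hq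
      exact hspec p u (q 1) hp hu (qS 1 (by lia)) hpQ hpu hq
    | succ i ih =>
      obtain ⟨h1, h2, h3⟩ := ih (by lia)
      have e1 := qE (2 * i + 1) (by lia)
      have e2 := qE (2 * i + 2) (by lia)
      have hQ2 : Q (q (2 * (i + 1))) := hQ' _ _ h2 e1
      refine ⟨hQ2, hQ _ _ hQ2 e2, h3.trans ?_⟩
      exact hspec (q (2 * i + 2)) _ _ (qS _ (by lia)) (qS _ (by lia)) (qS _ (by lia)) hQ2
        (by rw [Sym2.eq_swap]; exact e1) e2
  refine ⟨fun i hi => ?_, (walk k le_rfl).2⟩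
  rcases Nat.even_or_odd' i with ⟨a, rfl | rfl⟩
  · exact hQlev _ (walk a (by lia)).1
  · exact (walk a (by lia)).2.1.ge

end

/-! ### One edge per copy: the bound by the Turán number -/

theorem hasRainbowCopy_of_injOn {W U : Type*} {𝒞 : Finset (⊤ : SimpleGraph U).Subgraph}
    {G : SimpleGraph W} (col : Sym2 U → (⊤ : SimpleGraph U).Subgraph) (f : W ↪ U)
    (hf : ∀ e ∈ G.edgeSet, col (Sym2.map f e) ∈ 𝒞 ∧ Sym2.map f e ∈ (col (Sym2.map f e)).edgeSet)
    (hinj : Set.InjOn (fun e => col (Sym2.map f e)) G.edgeSet) : HasRainbowCopy 𝒞 G :=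
  ⟨f, fun e => col (Sym2.map f e), fun e e' h => Subtype.ext (hinj e.2 e'.2 h),
    fun e => hf e e.2⟩

/-- Every edge of a member of an edge-disjoint family determines that member. -/
theorem IsEdgeDisjointFamily.exists_colouring {V U : Type*} {F : SimpleGraph V}
    {𝒞 : Finset (⊤ : SimpleGraph U).Subgraph} (h𝒞 : IsEdgeDisjointFamily F 𝒞) :
    ∃ col : Sym2 U → (⊤ : SimpleGraph U).Subgraph, ∀ C ∈ 𝒞, ∀ e ∈ C.edgeSet, col e = C := by
  classical
  refine ⟨fun e => if h : ∃ C ∈ 𝒞, e ∈ C.edgeSet then h.choose else ⊥, fun C hC e he => ?_⟩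
  have h : ∃ C ∈ 𝒞, e ∈ C.edgeSet := ⟨C, hC, he⟩
  simp only [dif_pos h]
  by_contra hne
  exact Set.disjoint_left.1 (h𝒞.2 h.choose_spec.1 hC hne) h.choose_spec.2 he

theorem multicolorTuran_le_extremalNumber {V W : Type*} {F : SimpleGraph V} (hF : F ≠ ⊥) (n : ℕ)
    (G : SimpleGraph W) : multicolorTuran F n G ≤ SimpleGraph.extremalNumber n G := by
  classical
  refine csSup_le' ?_
  rintro t ⟨𝒞, h𝒞, hno, rfl⟩
  obtain ⟨col, hcol⟩ := h𝒞.exists_colouring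
  have hex : ∀ C ∈ 𝒞, ∃ e, e ∈ C.edgeSet := by
    intro C hC
    obtain ⟨φ⟩ := h𝒞.1 C hC
    obtain ⟨a, b, hab⟩ := SimpleGraph.ne_bot_iff_exists_adj.1 hF
    exact ⟨s(φ a, φ b), φ.map_adj_iff.2 hab⟩
  rcases 𝒞.eq_empty_or_nonempty with rfl | ⟨C₀, hC₀⟩
  · simp
  have : Nonempty (Sym2 (Fin n)) := (hex C₀ hC₀).nonempty
  choose! e he using hex
  have hecol : ∀ C ∈ 𝒞, col (e C) = C := fun C hC => hcol C hC _ (he C hC)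
  let H : SimpleGraph (Fin n) := SimpleGraph.fromEdgeSet (𝒞.image e : Finset (Sym2 (Fin n)))
  have hH : H.edgeFinset = 𝒞.image e := by
    ext d
    rw [SimpleGraph.mem_edgeFinset, SimpleGraph.edgeSet_fromEdgeSet, Set.mem_sdiff,
      Finset.mem_coe, and_iff_left_iff_imp]
    intro hd hdiag
    obtain ⟨C, hC, rfl⟩ := Finset.mem_image.1 hd
    exact SimpleGraph.not_isDiag_of_mem_edgeSet _ (C.edgeSet_subset (he C hC)) hdiag
  have hmem : ∀ d ∈ H.edgeSet, ∃ C ∈ 𝒞, e C = d := fun d hd => by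
    rwa [← SimpleGraph.mem_edgeFinset, hH, Finset.mem_image] at hd
  have hfree : G.Free H := by
    rintro ⟨f⟩
    have hf : ∀ d ∈ G.edgeSet, Sym2.map f d ∈ H.edgeSet := fun d hd =>
      f.toHom.map_mem_edgeSet hd
    refine hno (hasRainbowCopy_of_injOn col ⟨f, f.injective⟩ ?_ ?_)
    · intro d hd
      obtain ⟨C, hC, hCd⟩ := hmem _ (hf d hd)
      change col (Sym2.map f d) ∈ 𝒞 ∧ Sym2.map f d ∈ (col (Sym2.map f d)).edgeSet
      rw [← hCd, hecol C hC]
      exact ⟨hC, he C hC⟩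
    · intro d hd d' hd' heq
      change col (Sym2.map f d) = col (Sym2.map f d') at heq
      obtain ⟨C, hC, hCd⟩ := hmem _ (hf d hd)
      obtain ⟨C', hC', hCd'⟩ := hmem _ (hf d' hd')
      rw [← hCd, ← hCd', hecol C hC, hecol C' hC'] at heq
      subst heq
      exact Sym2.map.injective f.injective (hCd.symm.trans hCd')
  have hcard : H.edgeFinset.card = 𝒞.card := by
    rw [hH]
    refine Finset.card_image_of_injOn fun C hC C' hC' heq => ?_
    rw [← hecol C hC, heq, hecol C' hC']
  rw [← hcard]
  have := SimpleGraph.card_edgeFinset_le_extremalNumber hfree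
  rw [Fintype.card_fin] at this
  convert! this

/-! ### Even cycles: the Bondy–Simonovits theorem -/

section

variable {U : Type*} [Fintype U] [DecidableEq U] {G : SimpleGraph U} [DecidableRel G.Adj] {x : U}
  {ℓ : ℕ} {lev : U → ℕ} {par : U → U}

-- With `id` as colouring every edge set is rainbow. Tree edges change level, so edges inside a
-- level are fresh, and `Q` can be level `j` itself.
open Finset in
theorem IsRainbowTree.card_edges_within_level_le (hT : IsRainbowTree G id x ℓ lev par)
    (hfree : ¬ ∃ f, IsRainbowCycle G id (2 * ℓ) f) {j : ℕ} (hj : j < ℓ) :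
    #{e ∈ G.edgeFinset | ∀ v ∈ e, lev v = j} ≤ 2 * ℓ * #{v | lev v = j} := by
  set E := {e ∈ G.edgeFinset | ∀ v ∈ e, lev v = j} with hE
  by_contra! hlt
  have hmem : ∀ u v, s(u, v) ∈ E → G.Adj u v ∧ lev u = j ∧ lev v = j := fun u v h => by
    simpa [hE] using h
  obtain ⟨S, hSS, ⟨p, hp⟩, hdeg⟩ := exists_subset_forall_lt_card_neighbors E {v | lev v = j}
    (fun e he v hv => by simpa using (mem_filter.1 he).2 v hv) ((2 * ℓ : ℕ) : ℝ)
    (by exact_mod_cast hlt)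
  refine hfree (hT.exists_even_isRainbowCycle hj (E := E) ⟨?_, ?_, ?_⟩ (S := S)
    (fun v hv => by exact_mod_cast hdeg v hv) (fun v => lev v = j) (fun p hp => hp.ge)
    (fun p v _ h => (hmem p v h).2.2) (fun p v _ h => (hmem p v h).2.2)
    ⟨p, hp, by simpa using hSS hp⟩)
  · exact fun e he => SimpleGraph.mem_edgeFinset.1 (mem_filter.1 he).1
  · exact Function.injective_id.injOn
  · rintro e he y hy hyj rfl
    have h1 := hmem _ _ he
    have h2 := hT.lev_par y hy (by lia)
    lia

-- Here `Q` is level `j + 1`. Freshness is only required up to level `j`, so tree edges joining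
-- levels `j` and `j + 1` do no harm.
open Finset in
theorem IsRainbowTree.card_edges_between_levels_le (hT : IsRainbowTree G id x ℓ lev par)
    (hfree : ¬ ∃ f, IsRainbowCycle G id (2 * ℓ) f) {j : ℕ} (hj : j < ℓ) :
    #{e ∈ G.edgeFinset | ∃ u v, e = s(u, v) ∧ lev u = j ∧ lev v = j + 1} ≤
      2 * ℓ * (#{v | lev v = j} + #{v | lev v = j + 1}) := by
  set E := {e ∈ G.edgeFinset | ∃ u v, e = s(u, v) ∧ lev u = j ∧ lev v = j + 1} with hE
  by_contra! hlt
  have hmem : ∀ u v, s(u, v) ∈ E → (lev u = j ∧ lev v = j + 1) ∨ (lev u = j + 1 ∧ lev v = j) := by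
    intro u v h
    obtain ⟨-, a, b, hab, ha, hb⟩ := mem_filter.1 h
    rcases Sym2.eq_iff.1 hab with ⟨rfl, rfl⟩ | ⟨rfl, rfl⟩
    · exact Or.inl ⟨ha, hb⟩
    · exact Or.inr ⟨hb, ha⟩
  obtain ⟨S, hSS, ⟨p, hp⟩, hdeg⟩ := exists_subset_forall_lt_card_neighbors E
    (univ.filter (lev · = j) ∪ univ.filter (lev · = j + 1))
    (fun e he v hv => by
      obtain ⟨w, rfl⟩ := hv
      rcases hmem _ _ he with h | h <;> simp [h.1]) ((2 * ℓ : ℕ) : ℝ)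
    (by
      have := card_union_le ({v | lev v = j} : Finset U) {v | lev v = j + 1}
      exact_mod_cast (Nat.mul_le_mul_left (2 * ℓ) this).trans_lt hlt)
  have hdeg' : ∀ v ∈ S, 2 * ℓ < #{u ∈ S | s(v, u) ∈ E} := fun v hv => by
    exact_mod_cast hdeg v hv
  refine hfree (hT.exists_even_isRainbowCycle hj (E := E) ⟨?_, ?_, ?_⟩ (S := S) hdeg'
    (fun v => lev v = j + 1) (fun p hp => by lia)
    (fun p v hp h => by have := hmem p v h; lia) (fun p v hp h => by have := hmem p v h; lia) ?_)
  · exact fun e he => SimpleGraph.mem_edgeFinset.1 (mem_filter.1 he).1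
  · exact Function.injective_id.injOn
  · rintro e he y hy hyj rfl
    have h1 := hmem _ _ he
    have h2 := hT.lev_par y hy (by lia)
    lia
  · obtain ⟨u, hu⟩ := card_pos.1 (Nat.zero_lt_of_lt (hdeg' p hp))
    rw [mem_filter] at hu
    rcases hmem _ _ hu.2 with h | h
    · exact ⟨u, hu.1, h.2⟩
    · exact ⟨p, hp, h.1⟩

open Finset in
/-- In a `C_{2ℓ}`-free graph, the number of edges that meet the ball of radius `i < ℓ` is linear in
the size of the ball of radius `i + 1`. -/
theorem IsRainbowTree.card_edges_touching_le (hT : IsRainbowTree G id x ℓ lev par)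
    (hfree : ¬ ∃ f, IsRainbowCycle G id (2 * ℓ) f) {i : ℕ} (hi : i < ℓ) :
    #{e ∈ G.edgeFinset | ∃ v, lev v ≤ i ∧ v ∈ e} ≤ 6 * ℓ * #{v | lev v ≤ i + 1} := by
  have hsub : {e ∈ G.edgeFinset | ∃ v, lev v ≤ i ∧ v ∈ e} ⊆ (range (i + 1)).biUnion fun j =>
      {e ∈ G.edgeFinset | ∀ v ∈ e, lev v = j} ∪
        {e ∈ G.edgeFinset | ∃ u v, e = s(u, v) ∧ lev u = j ∧ lev v = j + 1} := by
    intro e he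
    obtain ⟨heG, v, hv, w, rfl⟩ := mem_filter.1 he
    have key : ∀ u w, s(u, w) ∈ G.edgeFinset → lev u ≤ lev w → lev u ≤ i →
        s(u, w) ∈ (range (i + 1)).biUnion fun j =>
          {e ∈ G.edgeFinset | ∀ v ∈ e, lev v = j} ∪
            {e ∈ G.edgeFinset | ∃ u v, e = s(u, v) ∧ lev u = j ∧ lev v = j + 1} := by
      intro u w huw hle hui
      refine mem_biUnion.2 ⟨lev u, by simp; lia, ?_⟩
      have hadj : G.Adj u w := by simpa using huw
      have hw : lev w ≤ lev u + 1 := by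
        -- Since colours are edges, an edge that skips a level would itself be a tree edge, but tree
        -- edges join consecutive levels.
        by_contra! hcon
        obtain ⟨y, hy0, hy1, hy⟩ := hT.maximal u w hadj (by lia) hcon
        have h2 := hT.lev_par y hy0 (by lia)
        rcases Sym2.eq_iff.1 hy with ⟨h3, h4⟩ | ⟨h3, h4⟩
        · rw [h4, h3] at h2; lia
        · rw [h4, h3] at h2; rw [h3] at hy1; lia
      rw [mem_union, mem_filter, mem_filter]
      rcases hle.eq_or_lt with h | h
      · exact Or.inl ⟨huw, by simp [h]⟩
      · exact Or.inr ⟨huw, u, w, rfl, rfl, by lia⟩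
    rcases le_total (lev v) (lev w) with h | h
    · exact key v w heG h hv
    · rw [Sym2.eq_swap]
      exact key w v (by rwa [Sym2.eq_swap]) h (by lia)
  have hlev : ∀ i, ∑ j ∈ range (i + 1), #{v | lev v = j} = #{v | lev v ≤ i} := by
    intro i
    rw [card_eq_sum_card_fiberwise (f := lev) (t := range (i + 1)) (by intro v; simp)]
    refine sum_congr rfl fun j hj => ?_
    congr 1
    ext v
    simp only [mem_filter, mem_univ, true_and, mem_range] at hj ⊢
    lia
  have h1 := hlev i
  have h2 : ∑ j ∈ range (i + 1), #{v | lev v = j + 1} ≤ #{v | lev v ≤ i + 1} := by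
    rw [← hlev (i + 1), sum_range_succ' _ (i + 1)]
    exact Nat.le_add_right _ _
  have h3 : #{v | lev v ≤ i} ≤ #{v | lev v ≤ i + 1} :=
    card_le_card fun v => by simp; lia
  calc _ ≤ _ := card_le_card hsub
    _ ≤ _ := card_biUnion_le
    _ ≤ ∑ j ∈ range (i + 1), (2 * ℓ * #{v | lev v = j} +
          2 * ℓ * (#{v | lev v = j} + #{v | lev v = j + 1})) := by
      refine sum_le_sum fun j hj => (card_union_le _ _).trans ?_
      have hj' : j < ℓ := by simp at hj; lia
      exact Nat.add_le_add (hT.card_edges_within_level_le hfree hj')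
        (hT.card_edges_between_levels_le hfree hj')
    _ = 2 * ℓ * (2 * #{v | lev v ≤ i} + ∑ j ∈ range (i + 1), #{v | lev v = j + 1}) := by
      rw [← h1, sum_add_distrib, ← mul_sum, ← mul_sum, sum_add_distrib]; ring
    _ ≤ 2 * ℓ * (2 * #{v | lev v ≤ i + 1} + #{v | lev v ≤ i + 1}) := by gcongr
    _ = _ := by ring

end

theorem pow_le_of_mul_le_succ {b : ℕ → ℝ} {ρ : ℝ} (hρ : 0 ≤ ρ) (r : ℕ) (h0 : 1 ≤ b 0)
    (h : ∀ i < r, ρ * b i ≤ b (i + 1)) : ρ ^ r ≤ b r := by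
  induction r with
  | zero => simpa using h0
  | succ r ih =>
    calc ρ ^ (r + 1) = ρ * ρ ^ r := by ring
      _ ≤ ρ * b r := by gcongr; exact ih fun i hi => h i (by lia)
      _ ≤ b (r + 1) := h r (by lia)

open Finset in
/-- The Bondy–Simonovits theorem. -/
theorem extremalNumber_cycleGraph_even_le {ℓ : ℕ} (hℓ : 1 ≤ ℓ) (n : ℕ) :
    (SimpleGraph.extremalNumber n (SimpleGraph.cycleGraph (2 * ℓ)) : ℝ) ≤
      24 * ℓ * (n : ℝ) ^ (1 + 1 / (ℓ : ℝ)) := by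
  rw [← Fintype.card_fin n, SimpleGraph.extremalNumber_le_iff_of_nonneg _ (by positivity),
    Fintype.card_fin]
  classical
  intro G _ hG
  by_contra! hlt
  have hn : 0 < n := by
    rcases Nat.eq_zero_or_pos n with rfl | h
    · have : #G.edgeFinset = 0 := by
        rw [card_eq_zero, SimpleGraph.edgeFinset_eq_empty]
        exact Subsingleton.elim _ _
      rw [this, Nat.cast_zero] at hlt
      exact absurd hlt (not_lt.2 (by positivity))
    · exact h
  have hnR : (0 : ℝ) < n := by exact_mod_cast hn
  have hℓR : (0 : ℝ) < ℓ := by exact_mod_cast hℓ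
  set ν := (n : ℝ) ^ (1 / (ℓ : ℝ)) with hν
  have hν0 : 0 < ν := Real.rpow_pos_of_pos hnR _
  have hνℓ : ν ^ ℓ = n := by
    rw [hν, one_div, Real.rpow_inv_natCast_pow hnR.le (by lia)]
  rw [Real.rpow_add hnR, Real.rpow_one, ← hν] at hlt
  obtain ⟨S, -, ⟨x, hx⟩, hS⟩ := exists_subset_forall_lt_card_neighbors G.edgeFinset univ
    (fun _ _ _ _ => mem_univ _) (24 * ℓ * ν) (by rw [card_univ, Fintype.card_fin]; linarith)
  -- Restricting to `S` keeps the tree inside `S`, where the degree bound holds.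
  let G' : SimpleGraph (Fin n) :=
    { Adj := fun u v => G.Adj u v ∧ u ∈ S ∧ v ∈ S
      symm := ⟨fun u v h => ⟨h.1.symm, h.2.2, h.2.1⟩⟩
      loopless := ⟨fun u h => G.loopless.irrefl u h.1⟩ }
  have hdeg : ∀ v ∈ S, 24 * ℓ * ν ≤ #{e ∈ G'.edgeFinset | v ∈ e.toFinset} := by
    intro v hv
    refine (hS v hv).le.trans ?_
    norm_cast
    refine card_le_card_of_injOn (fun u => s(v, u)) ?_ ?_
    · intro u hu
      simp only [coe_filter, Set.mem_ofPred_eq, SimpleGraph.mem_edgeFinset,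
        SimpleGraph.mem_edgeSet] at hu
      simp [G', hu, hv]
    · intro u _ u' _ h
      exact Sym2.congr_right.1 h
  have hfree : ¬ ∃ f, IsRainbowCycle G' id (2 * ℓ) f := by
    rintro ⟨f, hf⟩
    obtain ⟨g, hg, -⟩ := hf.exists_embedding (by lia)
    refine hG ⟨⟨⟨g, fun {a b} hab => ?_⟩, g.injective⟩⟩
    have : G'.Adj (g a) (g b) := hg s(a, b) hab
    exact this.1
  obtain ⟨lev, par, hT⟩ := exists_isRainbowTree G' id x ℓ
  have hlevS : ∀ v, lev v ≤ ℓ → v ∈ S := by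
    intro v hv
    rcases Nat.eq_zero_or_pos (lev v) with h | h
    · rw [(hT.lev_eq_zero v).1 h]; exact hx
    · exact (hT.adj v h hv).2.1
  -- Double counting gives `24ℓν |B_i| ≤ 2 · 6ℓ |B_{i+1}|`, so balls grow by `2ν` per level and the
  -- last one has at least `2^ℓ n > n` vertices.
  have key := pow_le_of_mul_le_succ (b := fun i => (#{v | lev v ≤ i} : ℝ)) (ρ := 2 * ν)
    (by positivity) ℓ ?_ ?_
  · have h1 : #{v | lev v ≤ ℓ} ≤ n := by simpa using card_le_univ {v | lev v ≤ ℓ}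
    have h2 : (#{v | lev v ≤ ℓ} : ℝ) ≤ n := by exact_mod_cast h1
    have h3 : (2 : ℝ) ≤ 2 ^ ℓ := by
      calc (2 : ℝ) = 2 ^ 1 := by norm_num
        _ ≤ 2 ^ ℓ := pow_le_pow_right₀ (by norm_num) hℓ
    rw [mul_pow, hνℓ] at key
    nlinarith
  · have : 0 < #{v | lev v ≤ 0} := card_pos.2 ⟨x, by simp [hT.lev_eq_zero]⟩
    exact_mod_cast this
  · intro i hi
    have h1 := mul_card_le_mul_card_touching G'.edgeFinset (fun e => e.toFinset) 2
      (fun e _ => by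
        induction e with
        | _ a b => rw [Sym2.toFinset_mk_eq]; exact card_le_two)
      {v | lev v ≤ i} (24 * ℓ * ν)
      (fun v hv => hdeg v (hlevS v (by simp at hv; lia)))
    have h2 : 24 * ℓ * ν * #{v | lev v ≤ i} ≤
        (2 : ℕ) * ((6 * ℓ * #{v | lev v ≤ i + 1} : ℕ) : ℝ) := by
      refine h1.trans ?_
      gcongr
      refine (card_le_card fun e he => ?_).trans (hT.card_edges_touching_le hfree hi)
      simpa using he
    have h3 : (12 * ℓ : ℝ) * (2 * ν * #{v | lev v ≤ i}) ≤ (12 * ℓ) * #{v | lev v ≤ i + 1} := by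
      push_cast at h2
      linarith
    exact le_of_mul_le_mul_left h3 (by positivity)

/-! ### Odd cycles -/

/-- A closed walk of length `2k + 1` that starts at height at most `i` and can climb only one level
per step stays below `i + k` and has a horizontal step. -/
theorem exists_horizontal_step (L : ℕ → ℕ) (k i : ℕ) (h0 : L 0 ≤ i)
    (hclosed : L (2 * k + 1) = L 0)
    (hup : ∀ a < 2 * k + 1, L a < i + k → L (a + 1) ≤ L a + 1)
    (hdown : ∀ a < 2 * k + 1, L (a + 1) < i + k → L a ≤ L (a + 1) + 1) :
    ∃ a < 2 * k + 1, L a = L (a + 1) ∧ L a ≤ i + k := by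
  -- Climbing is controlled from both ends: `k` steps forwards and `k` steps backwards from the
  -- start cover the closed walk.
  have hfwd : ∀ a ≤ k, L a ≤ i + a := by
    intro a ha
    induction a with
    | zero => simpa using h0
    | succ a ih =>
      have h1 := ih (by lia)
      have h2 := hup a (by lia) (by lia)
      lia
  have hbwd : ∀ a ≤ k, L (2 * k + 1 - a) ≤ i + a := by
    intro a ha
    induction a with
    | zero => rw [Nat.sub_zero, hclosed]; simpa using h0
    | succ a ih =>
      have h1 := ih (by lia)
      have h2 := hdown (2 * k + 1 - (a + 1)) (by lia)
      rw [show 2 * k + 1 - (a + 1) + 1 = 2 * k + 1 - a by lia] at h2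
      have := h2 (by lia)
      lia
  have hle : ∀ a ≤ 2 * k + 1, L a ≤ i + k := by
    intro a ha
    rcases Nat.lt_or_ge k a with h | h
    · have := hbwd (2 * k + 1 - a) (by lia)
      rw [show 2 * k + 1 - (2 * k + 1 - a) = a by lia] at this
      lia
    · have := hfwd a h
      lia
  by_contra! hcon
  -- Without a horizontal step each level change is `±1`, so `L a + a` keeps its parity, which fails
  -- after an odd closed walk.
  have hpar : ∀ a ≤ 2 * k + 1, (L a + a) % 2 = L 0 % 2 := by
    intro a ha
    induction a with
    | zero => rfl
    | succ a ih =>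
      have h1 := ih (by lia)
      have h2 := hle a (by lia)
      have h3 := hle (a + 1) ha
      have h4 : L a ≠ L (a + 1) := fun h => absurd (hcon a (by lia) h) (by lia)
      have h5 := hup a (by lia)
      have h6 := hdown a (by lia)
      rcases Nat.lt_or_gt_of_ne h4 with h | h
      · have := h5 (by lia)
        lia
      · have := h6 (by lia)
        lia
  have := hpar (2 * k + 1) le_rfl
  rw [hclosed] at this
  lia

open scoped Fin.CommRing in
/-- A copy of the cycle `C_N` can be traversed starting from any of its vertices. -/
theorem exists_traversal {U : Type*} {H : SimpleGraph U} {N : ℕ} (hN : 2 ≤ N) {C : H.Subgraph}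
    (φ : SimpleGraph.cycleGraph N ≃g C.coe) {v : U} (hv : v ∈ C.verts) :
    ∃ g : ℕ → U, g 0 = v ∧ g N = v ∧ ∀ a, C.Adj (g a) (g (a + 1)) := by
  obtain ⟨N, rfl⟩ : ∃ M, N = M + 2 := ⟨N - 2, by lia⟩
  have hφ : ((φ (φ.symm ⟨v, hv⟩)) : U) = v := by rw [φ.apply_symm_apply]
  refine ⟨fun a => φ (φ.symm ⟨v, hv⟩ + (a : Fin (N + 2))), ?_, ?_, fun a => ?_⟩
  · simp
  · simp
  · refine φ.map_adj_iff.2 (SimpleGraph.cycleGraph_adj.2 (Or.inr ?_))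
    push_cast
    ring

/-- The union of a family of subgraphs. -/
def familyGraph {U : Type*} (𝒞 : Finset (⊤ : SimpleGraph U).Subgraph) : SimpleGraph U where
  Adj u v := ∃ C ∈ 𝒞, C.Adj u v
  symm := ⟨fun _ _ ⟨C, hC, h⟩ => ⟨C, hC, h.symm⟩⟩
  loopless := ⟨fun _ ⟨_, _, h⟩ => h.adj_sub.ne rfl⟩

section

variable {U : Type*} [Fintype U] {x : U} {ℓ : ℕ} {lev : U → ℕ} {par : U → U}
  {𝒞 : Finset (⊤ : SimpleGraph U).Subgraph} {col : Sym2 U → (⊤ : SimpleGraph U).Subgraph}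

-- Every copy through the root has an edge `xw` there. Either `w` is on level 1 and `xw` is its
-- parent edge, or maximality puts the colour on another tree edge at level 1.
open Finset in
open scoped Classical in
theorem IsRainbowTree.card_copies_through_root_le
    (hT : IsRainbowTree (familyGraph 𝒞) col x ℓ lev par)
    (hcol : ∀ C ∈ 𝒞, ∀ e ∈ C.edgeSet, col e = C) (hℓ : 1 ≤ ℓ)
    (hnbr : ∀ C ∈ 𝒞, ∀ v ∈ C.verts, ∃ w, C.Adj v w) :
    #{C ∈ 𝒞 | x ∈ C.verts} ≤ #{v | lev v ≤ 1} := by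
  have hx : lev x = 0 := (hT.lev_eq_zero x).2 rfl
  refine (card_le_card ?_).trans
    (card_image_le (s := {v | lev v ≤ 1}) (f := fun y => col s(y, par y)))
  intro C hC
  rw [mem_filter] at hC
  obtain ⟨w, hw⟩ := hnbr C hC.1 x hC.2
  have hCw : col s(x, w) = C := hcol C hC.1 _ hw
  rw [mem_image]
  rcases Nat.lt_or_ge 1 (lev w) with h | h
  · obtain ⟨y, hy0, hy1, hy⟩ := hT.maximal x w ⟨C, hC.1, hw⟩ (by lia) (by lia)
    exact ⟨y, by simp; lia, hy.trans hCw⟩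
  · have hw0 : lev w ≠ 0 := fun h0 => hw.adj_sub.ne ((hT.lev_eq_zero w).1 h0).symm
    have hpw := hT.lev_par w (by lia) (by lia)
    have hpx : par w = x := (hT.lev_eq_zero _).1 (by lia)
    exact ⟨w, by simpa using h, by rw [hpx, Sym2.eq_swap, hCw]⟩

open Finset in
open scoped Classical in
/-- If there is no rainbow `C_{2ℓ+1}`, the number of copies of `C_{2k+1}` that meet the ball of
radius `i` is linear in the size of the ball of radius `i + k`. -/
theorem IsRainbowTree.card_copies_touching_le {k : ℕ} (hk : 1 ≤ k)
    (hT : IsRainbowTree (familyGraph 𝒞) col x ℓ lev par)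
    (hcol : ∀ C ∈ 𝒞, ∀ e ∈ C.edgeSet, col e = C)
    (hC : ∀ C ∈ 𝒞, Nonempty (SimpleGraph.cycleGraph (2 * k + 1) ≃g C.coe))
    (hfree : ¬ ∃ f, IsRainbowCycle (familyGraph 𝒞) col (2 * ℓ + 1) f) {i : ℕ} (hi : i + k ≤ ℓ) :
    #{C ∈ 𝒞 | ∃ v, lev v ≤ i ∧ v ∈ C.verts} ≤ (2 * ℓ + 1) * #{v | lev v ≤ i + k} := by
  set B : Finset U := {v | lev v ≤ i + k} with hB
  -- The root has no parent edge; its meaningless colour only enlarges `used`, still of size at most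
  -- `#B`.
  set used := B.image (fun y => col s(y, par y)) with hused
  set K := {C ∈ 𝒞 | ∃ v, lev v ≤ i ∧ v ∈ C.verts} with hK
  have hhor : ∀ C ∈ K.filter (· ∉ used), ∃ e ∈ C.edgeSet,
      (∀ u v, e = s(u, v) → lev u = lev v) ∧ ∀ v ∈ e, lev v ≤ i + k := by
    intro C hCK
    obtain ⟨⟨hC𝒞, v, hv, hvC⟩, hCu⟩ : (C ∈ 𝒞 ∧ ∃ v, lev v ≤ i ∧ v ∈ C.verts) ∧ C ∉ used := by
      simpa [hK] using hCK
    have hjump : ∀ u w, C.Adj u w → lev u < i + k → lev w ≤ lev u + 1 := by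
      intro u w huw hu
      by_contra! hcon
      obtain ⟨y, hy0, hy1, hy⟩ := hT.maximal u w ⟨C, hC𝒞, huw⟩ (by lia) hcon
      exact hCu (mem_image.2 ⟨y, by simp [hB]; lia, hy.trans (hcol C hC𝒞 _ huw)⟩)
    obtain ⟨φ⟩ := hC C hC𝒞
    obtain ⟨g, g0, gN, gadj⟩ := exists_traversal (by lia) φ hvC
    obtain ⟨a, -, ha, ha'⟩ := exists_horizontal_step (fun a => lev (g a)) k i
      (by rw [g0]; exact hv) (by rw [g0, gN]) (fun a _ => hjump _ _ (gadj a))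
      (fun a _ => hjump _ _ (gadj a).symm)
    refine ⟨s(g a, g (a + 1)), gadj a, fun u v huv => ?_, fun v hv => ?_⟩
    · rcases Sym2.eq_iff.1 huv with ⟨rfl, rfl⟩ | ⟨rfl, rfl⟩
      · exact ha
      · exact ha.symm
    · rcases Sym2.mem_iff.1 hv with rfl | rfl
      · exact ha'
      · exact ha ▸ ha'
  have hfresh : #(K.filter (· ∉ used)) ≤ 2 * ℓ * #B := by
    by_contra! hlt
    obtain ⟨C₀, hC₀⟩ := card_pos.1 (Nat.zero_lt_of_lt hlt)
    have : Nonempty (Sym2 U) := (hhor C₀ hC₀).nonempty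
    choose! e heC helev heB using hhor
    -- One horizontal edge per copy: the colours are distinct and, as the copies are not in `used`,
    -- absent from the tree.
    set E := (K.filter (· ∉ used)).image e with hE
    have hK𝒞 : ∀ C ∈ K.filter (· ∉ used), C ∈ 𝒞 ∧ C ∉ used := fun C hC =>
      ⟨(mem_filter.1 (mem_filter.1 hC).1).1, (mem_filter.1 hC).2⟩
    have hecol : ∀ C ∈ K.filter (· ∉ used), col (e C) = C := fun C hC =>
      hcol C (hK𝒞 C hC).1 _ (heC C hC)
    have hEcard : #E = #(K.filter (· ∉ used)) :=
      card_image_of_injOn fun C hC C' hC' heq => by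
        rw [← hecol C hC, heq, hecol C' hC']
    obtain ⟨S, hSB, hSne, hdeg⟩ := exists_subset_forall_lt_card_neighbors E B
      (fun d hd v hv => by
        obtain ⟨C, hC, rfl⟩ := mem_image.1 hd
        simpa [hB] using heB C hC v hv) ((2 * ℓ : ℕ) : ℝ)
      (by rw [hEcard]; exact_mod_cast hlt)
    refine hfree (hT.exists_odd_isRainbowCycle hi (E := E) ⟨?_, ?_, ?_⟩ hSne
      (fun v hv => by simpa [hB] using hSB hv) (fun v hv => by exact_mod_cast hdeg v hv) ?_)
    · intro d hd
      obtain ⟨C, hC, rfl⟩ := mem_image.1 hd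
      have := heC C hC
      induction h : e C with
      | _ a b =>
        rw [h] at this
        exact ⟨C, (hK𝒞 C hC).1, this⟩
    · intro d hd d' hd' heq
      obtain ⟨C, hC, rfl⟩ := mem_image.1 hd
      obtain ⟨C', hC', rfl⟩ := mem_image.1 hd'
      rw [hecol C hC, hecol C' hC'] at heq
      rw [heq]
    · intro d hd y _ hy heq
      obtain ⟨C, hC, rfl⟩ := mem_image.1 hd
      rw [hecol C hC] at heq
      exact (hK𝒞 C hC).2 (mem_image.2 ⟨y, by simpa [hB] using hy, heq⟩)
    · intro u v huv
      obtain ⟨C, hC, h⟩ := mem_image.1 huv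
      exact helev C hC u v h
  calc #K = #(K.filter (· ∈ used)) + #(K.filter (· ∉ used)) :=
        (card_filter_add_card_filter_not _).symm
    _ ≤ #B + 2 * ℓ * #B := by
        refine Nat.add_le_add ?_ hfresh
        exact (card_le_card fun C hC => (mem_filter.1 hC).2).trans card_image_le
    _ = _ := by ring

end

open Finset in
theorem multicolorTuran_cycleGraph_odd_le {k ℓ : ℕ} (hk : 1 ≤ k) (hkℓ : k < ℓ) (n : ℕ) :
    (multicolorTuran (SimpleGraph.cycleGraph (2 * k + 1)) n
        (SimpleGraph.cycleGraph (2 * ℓ + 1)) : ℝ) ≤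
      8 * ((k : ℝ) + 1) ^ 2 * (ℓ : ℝ) * (n : ℝ) ^ (1 + 1 / (⌈(ℓ : ℝ) / (k : ℝ)⌉₊ : ℝ)) := by
  classical
  -- The supremum is taken in `ℕ`, so the real bound is replaced by its floor.
  rw [← Nat.le_floor_iff (by positivity)]
  refine csSup_le' ?_
  rintro t ⟨𝒞, h𝒞, hno, rfl⟩
  rw [Nat.le_floor_iff (by positivity)]
  obtain ⟨col, hcol⟩ := h𝒞.exists_colouring
  have hkR : (0 : ℝ) < k := by exact_mod_cast hk
  have hℓR : (1 : ℝ) ≤ ℓ := by exact_mod_cast (by lia : 1 ≤ ℓ)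
  by_contra! hlt
  have hne : ∀ C ∈ 𝒞, ∃ v, v ∈ C.verts := fun C hC => by
    obtain ⟨φ⟩ := h𝒞.1 C hC
    exact ⟨φ 0, (φ 0).2⟩
  have hn : 0 < n := by
    have h0 : (0 : ℝ) < #𝒞 := lt_of_le_of_lt (by positivity) hlt
    obtain ⟨C, hC⟩ := card_pos.1 (by exact_mod_cast h0 : 0 < #𝒞)
    obtain ⟨v, -⟩ := hne C hC
    exact Fin.pos v
  have hnR : (0 : ℝ) < n := by exact_mod_cast hn
  set r := ⌈(ℓ : ℝ) / (k : ℝ)⌉₊ with hr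
  have hr0 : 0 < r := Nat.ceil_pos.2 (by positivity)
  have hrk : (r - 1) * k < ℓ := by
    have h1 : ((r - 1 : ℕ) : ℝ) < ℓ / k := Nat.lt_ceil.1 (by lia)
    rw [lt_div_iff₀ hkR] at h1
    exact_mod_cast h1
  set ν := (n : ℝ) ^ (1 / (r : ℝ)) with hν
  have hν0 : 0 < ν := Real.rpow_pos_of_pos hnR _
  have hνr : ν ^ r = n := by
    rw [hν, one_div, Real.rpow_inv_natCast_pow hnR.le (by lia)]
  rw [Real.rpow_add hnR, Real.rpow_one, ← hν] at hlt
  -- The constant absorbs `(2k + 1)(2ℓ + 1)`: vertices per copy times copies per vertex of the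
  -- larger ball.
  set d := 8 * ((k : ℝ) + 1) ^ 2 * ℓ * ν with hd
  have hd0 : 0 < d := by positivity
  obtain ⟨S, -, ⟨x, hx⟩, hS⟩ := exists_subset_forall_lt_degree 𝒞 (fun C => C.verts.toFinset)
    (fun C hC => by
      obtain ⟨v, hv⟩ := hne C hC
      exact ⟨v, by simpa using hv⟩) univ (fun _ _ => subset_univ _) d
    (by rw [card_univ, Fintype.card_fin]; linarith)
  set 𝒟 := {C ∈ 𝒞 | C.verts.toFinset ⊆ S} with h𝒟
  have h𝒟𝒞 : ∀ C ∈ 𝒟, C ∈ 𝒞 := fun C hC => (mem_filter.1 hC).1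
  have h𝒟S : ∀ C ∈ 𝒟, ∀ v ∈ C.verts, v ∈ S := fun C hC v hv =>
    (mem_filter.1 hC).2 (by simpa using hv)
  have hdeg : ∀ v ∈ S, d < #{C ∈ 𝒟 | v ∈ C.verts.toFinset} := by
    intro v hv
    rw [h𝒟, filter_filter]
    exact hS v hv
  have hcol𝒟 : ∀ C ∈ 𝒟, ∀ e ∈ C.edgeSet, col e = C := fun C hC => hcol C (h𝒟𝒞 C hC)
  have hiso : ∀ C ∈ 𝒟, Nonempty (SimpleGraph.cycleGraph (2 * k + 1) ≃g C.coe) :=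
    fun C hC => h𝒞.1 C (h𝒟𝒞 C hC)
  have hfree : ¬ ∃ f, IsRainbowCycle (familyGraph 𝒟) col (2 * ℓ + 1) f := by
    rintro ⟨f, hf⟩
    obtain ⟨g, hg, hinj⟩ := hf.exists_embedding (by lia)
    refine hno (hasRainbowCopy_of_injOn col g (fun e he => ?_) hinj)
    have h1 := hg e he
    induction h : Sym2.map g e with
    | _ a b =>
      rw [h] at h1
      obtain ⟨C, hC, hab⟩ := h1
      rw [hcol𝒟 C hC _ hab]
      exact ⟨h𝒟𝒞 C hC, hab⟩
  obtain ⟨lev, par, hT⟩ := exists_isRainbowTree (familyGraph 𝒟) col x ℓ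
  have hlevS : ∀ v, lev v ≤ ℓ → v ∈ S := by
    intro v hv
    rcases Nat.eq_zero_or_pos (lev v) with h | h
    · rw [(hT.lev_eq_zero v).1 h]; exact hx
    · obtain ⟨C, hC, hadj⟩ := hT.adj v h hv
      exact h𝒟S C hC v hadj.fst_mem
  have hroot : d ≤ #{v | lev v ≤ 1} := by
    refine (hdeg x hx).le.trans ?_
    norm_cast
    refine (card_le_card fun C hC => ?_).trans
      (hT.card_copies_through_root_le hcol𝒟 (by lia) fun C hC v hv => ?_)
    · simpa using hC
    · obtain ⟨φ⟩ := hiso C hC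
      obtain ⟨g, g0, -, gadj⟩ := exists_traversal (by lia) φ hv
      exact ⟨g 1, g0 ▸ gadj 0⟩
  have hgrow : ∀ i, i + k ≤ ℓ →
      ν * #{v | lev v ≤ i} ≤ (#{v | lev v ≤ i + k} : ℝ) := by
    intro i hi
    have h1 := mul_card_le_mul_card_touching 𝒟 (fun C => C.verts.toFinset) (2 * k + 1)
      (fun C hC => by
        obtain ⟨φ⟩ := hiso C hC
        rw [Set.toFinset_card, ← Fintype.card_congr φ.toEquiv, Fintype.card_fin])
      {v | lev v ≤ i} d (fun v hv => (hdeg v (hlevS v (by simp at hv; lia))).le)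
    have h2 : d * #{v | lev v ≤ i} ≤
        (2 * k + 1 : ℕ) * (((2 * ℓ + 1) * #{v | lev v ≤ i + k} : ℕ) : ℝ) := by
      refine h1.trans ?_
      gcongr
      refine (card_le_card fun C hC => ?_).trans
        (hT.card_copies_touching_le hk hcol𝒟 hiso hfree hi)
      simpa using hC
    have h3 : (2 * (k : ℝ) + 1) * (2 * ℓ + 1) ≤ 8 * ((k : ℝ) + 1) ^ 2 * ℓ :=
      calc (2 * (k : ℝ) + 1) * (2 * ℓ + 1) ≤ (2 * (k + 1)) * (4 * (k + 1) * ℓ) := by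
            gcongr
            · linarith
            · nlinarith
        _ = _ := by ring
    refine le_of_mul_le_mul_left (a := 8 * ((k : ℝ) + 1) ^ 2 * ℓ) ?_ (by positivity)
    push_cast at h2
    calc _ = d * #{v | lev v ≤ i} := by rw [hd]; ring
      _ ≤ (2 * (k : ℝ) + 1) * (2 * ℓ + 1) * #{v | lev v ≤ i + k} := by linarith
      _ ≤ _ := by gcongr
  -- Starting at radius `a ≥ 1`, where the ball already has `d` vertices, `r - 1` rounds of `k`
  -- levels end exactly at radius `ℓ`. This gives `ν^(r-1) d = 8(k+1)²ℓ n > n` vertices.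
  obtain ⟨a, ha, ha1⟩ : ∃ a, a + (r - 1) * k = ℓ ∧ 1 ≤ a :=
    ⟨ℓ - (r - 1) * k, by lia, by lia⟩
  have key := pow_le_of_mul_le_succ (b := fun i => (#{v | lev v ≤ a + i * k} : ℝ) / d) (ρ := ν)
    hν0.le (r - 1) ?_ ?_
  · simp only [ha] at key
    rw [le_div_iff₀ hd0] at key
    have h1 : #{v | lev v ≤ ℓ} ≤ n := by simpa using card_le_univ {v | lev v ≤ ℓ}
    have h2 : (#{v | lev v ≤ ℓ} : ℝ) ≤ n := by exact_mod_cast h1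
    have h3 : ν ^ (r - 1) * d = 8 * ((k : ℝ) + 1) ^ 2 * ℓ * n := by
      rw [hd, ← hνr]
      obtain ⟨s, hs⟩ : ∃ s, r = s + 1 := ⟨r - 1, by lia⟩
      rw [hs, Nat.add_sub_cancel]
      ring
    have h4 : (1 : ℝ) < 8 * ((k : ℝ) + 1) ^ 2 * ℓ := by nlinarith
    nlinarith
  · rw [le_div_iff₀ hd0, one_mul]
    refine hroot.trans ?_
    norm_cast
    exact card_le_card fun v => by simp; lia
  · intro i hi
    rw [mul_div_assoc']
    gcongr
    have h1 : (i + 1) * k ≤ (r - 1) * k := Nat.mul_le_mul_right k (by lia)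
    have h2 := hgrow (a + i * k) (by lia)
    rwa [show a + i * k + k = a + (i + 1) * k by ring] at h2

theorem mainTheorem2 {V W : Type*} [Fintype V] [Fintype W]
    (F : SimpleGraph V) (G : SimpleGraph W) :
    -- (1), general bound, for `F` with at least one edge
    (F ≠ ⊥ → G.IsBipartite →
      (fun n : ℕ => (multicolorTuran F n G : ℝ)) =O[atTop]
        (fun n : ℕ => (SimpleGraph.extremalNumber n G : ℝ))) ∧
    -- (1), even cycles
    (∀ s ℓ : ℕ, 3 ≤ s → 1 ≤ ℓ →
      (fun n : ℕ =>
        (multicolorTuran (SimpleGraph.cycleGraph s) n (SimpleGraph.cycleGraph (2 * ℓ)) : ℝ))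
        =O[atTop] (fun n : ℕ => (n : ℝ) ^ (1 + 1 / (ℓ : ℝ)))) ∧
    -- (2), odd cycles
    (∀ k ℓ : ℕ, 1 ≤ k → k < ℓ → ∀ n : ℕ,
      (multicolorTuran (SimpleGraph.cycleGraph (2 * k + 1)) n
          (SimpleGraph.cycleGraph (2 * ℓ + 1)) : ℝ)
        ≤ 8 * ((k : ℝ) + 1) ^ 2 * (ℓ : ℝ)
            * (n : ℝ) ^ (1 + 1 / (⌈(ℓ : ℝ) / (k : ℝ)⌉₊ : ℝ))) := by
  refine ⟨fun hF _ => ?_, fun s ℓ hs hℓ => ?_, fun k ℓ hk hkℓ n =>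
    multicolorTuran_cycleGraph_odd_le hk hkℓ n⟩
  · refine IsBigO.of_bound 1 (Eventually.of_forall fun n => ?_)
    rw [one_mul, Real.norm_natCast, Real.norm_natCast]
    exact_mod_cast multicolorTuran_le_extremalNumber hF n G
  · have hne : SimpleGraph.cycleGraph s ≠ ⊥ := by
      obtain ⟨s, rfl⟩ : ∃ m, s = m + 2 := ⟨s - 2, by lia⟩
      exact SimpleGraph.ne_bot_iff_exists_adj.2
        ⟨0, 1, SimpleGraph.cycleGraph_adj.2 (Or.inr (sub_zero 1))⟩
    refine IsBigO.of_bound (24 * ℓ) (Eventually.of_forall fun n => ?_)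
    rw [Real.norm_natCast, Real.norm_of_nonneg (by positivity)]
    refine le_trans ?_ (extremalNumber_cycleGraph_even_le hℓ n)
    exact_mod_cast multicolorTuran_le_extremalNumber hne n _
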